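/- Let $n\ge 0$ be an integer, let $X\subset\mathbb P^{n+1}_{\mathbb C}$ be a reduced hypersurface (not necessarily irreducible), let $Y$ be a reduced scheme of finite type over $\mathbb C$ of dimension $n$, and let $f\colon Y\to X$ be a finite birational morphism, i.e. there is a dense open $U\subset X$ with $f^{-1}(U)$ dense in $Y$ such that $f^{-1}(U)\to U$ is an isomorphism. For an integer $i\ge 0$ let $S_i(f)$ be the set of closed points $y\in Y$ at which the induced map of Zariski tangent spaces $df_y\colon T_yY\to T_{f(y)}X$ satisfies $\operatorname{rank} df_y\le \dim Y-i$. If $y\in S_i(f)$, then the multiplicity of the hypersurface $X$ at the point $f(y)$, that is, the order of vanishing at $f(y)$ of a local equation of $X$ in $\mathbb P^{n+1}$, is at least $2^i$. -/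

import Mathlib

open AlgebraicGeometry CategoryTheory IsLocalRing

noncomputable section

attribute [local instance] MvPolynomial.gradedAlgebra

/-- The map `𝔪_A / 𝔪_A² → 𝔪_B / 𝔪_B²` induced by a local homomorphism `φ : A → B` of local rings;
it is semilinear over the map of residue fields. -/
def coschemeTangentMap {A B : Type} [CommRing A] [CommRing B] [IsLocalRing A] [IsLocalRing B]
    (φ : A →+* B) [IsLocalHom φ] :
    CotangentSpace A →ₛₗ[ResidueField.map φ] CotangentSpace B :=
  letI : Algebra A B := φ.toAlgebra
  have h : maximalIdeal A ≤ (maximalIdeal B).comap (Algebra.ofId A B) :=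
    ((IsLocalRing.local_hom_TFAE φ).out 0 3).mp ‹_›
  { toFun := Ideal.mapCotangent (maximalIdeal A) (maximalIdeal B) (Algebra.ofId A B) h
    map_add' := map_add _
    map_smul' := by
      intro r v
      obtain ⟨a, rfl⟩ := residue_surjective r
      rw [ResidueField.map_residue]
      change Ideal.mapCotangent _ _ _ h (a • v) = φ a • Ideal.mapCotangent _ _ _ h v
      rw [map_smul]
      rfl }

theorem coschemeTangentMap_toCotangent {A B : Type} [CommRing A] [CommRing B] [IsLocalRing A]
    [IsLocalRing B] (φ : A →+* B) [IsLocalHom φ] (a : maximalIdeal A) (h : φ a ∈ maximalIdeal B) :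
    coschemeTangentMap φ ((maximalIdeal A).toCotangent a) = (maximalIdeal B).toCotangent ⟨φ a, h⟩ :=
  rfl

/-- The Zariski tangent space `T_y Y = (𝔪_y / 𝔪_y²)^∨` of a scheme at a point. -/
abbrev TangentSpaceAt (Y : Scheme.{0}) (y : Y) : Type :=
  Module.Dual (ResidueField (Y.presheaf.stalk y)) (CotangentSpace (Y.presheaf.stalk y))

/-- The differential `df_y : T_y Y → T_{f(y)} X ⊗ κ(y)` of a morphism `f : Y ⟶ X`, precomposition
with the map of cotangent spaces. Its target is written as the space of `κ(f(y))`-semilinear maps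
`𝔪_{f(y)} / 𝔪_{f(y)}² → κ(y)`, which is `T_{f(y)} X` when `κ(f(y)) = κ(y)`, as is the case at
closed points of schemes of finite type over `ℂ`. -/
def schemeTangentMap {X Y : Scheme.{0}} (f : Y ⟶ X) (y : Y) :
    TangentSpaceAt Y y →ₗ[ResidueField (Y.presheaf.stalk y)]
      (CotangentSpace (X.presheaf.stalk (f y))
        →ₛₗ[ResidueField.map (f.stalkMap y).hom] ResidueField (Y.presheaf.stalk y)) where
  toFun l := l.comp (coschemeTangentMap (f.stalkMap y).hom)
  map_add' _ _ := rfl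
  map_smul' _ _ := rfl

/-- The locus `S_i(f)` of closed points `y` of `Y` with `rank df_y ≤ dim Y - i`. -/
def dropLocus {X Y : Scheme.{0}} (f : Y ⟶ X) (i : ℕ) : Set Y :=
  {y | IsClosed {y} ∧
    ((Module.finrank (ResidueField (Y.presheaf.stalk y)) (LinearMap.range (schemeTangentMap f y)) + i : ℕ)
      : WithBot ℕ∞) ≤ topologicalKrullDim Y}

/-- Projective `N`-space over `ℂ`. -/
abbrev ProjSpaceC (N : ℕ) : Scheme.{0} :=
  Proj (MvPolynomial.homogeneousSubmodule (Fin (N + 1)) ℂ)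

/-- A closed immersion `ι : X ⟶ ℙ^N` exhibits `X` as a (reduced) hypersurface: `X` is reduced, and
its underlying set is the zero locus of a nonzero form of positive degree. -/
def IsHypersurface {N : ℕ} {X : Scheme.{0}} (ι : X ⟶ ProjSpaceC N) : Prop :=
  IsClosedImmersion ι ∧ IsReduced X ∧
    ∃ (d : ℕ) (F : MvPolynomial (Fin (N + 1)) ℂ), 0 < d ∧ F.IsHomogeneous d ∧ F ≠ 0 ∧
      Set.range ι =
        ProjectiveSpectrum.zeroLocus (MvPolynomial.homogeneousSubmodule (Fin (N + 1)) ℂ) {F}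

/-- A morphism is birational if it restricts to an isomorphism between dense open subschemes. -/
def IsBirationalMorphism {X Y : Scheme.{0}} (f : Y ⟶ X) : Prop :=
  ∃ U : X.Opens, Dense (U : Set X) ∧ Dense ((f ⁻¹ᵁ U : Y.Opens) : Set Y) ∧ IsIso (f ∣_ U)

/-- The multiplicity at `x` of a hypersurface `ι : X ⟶ ℙ^N`: the order of vanishing at `x` of a
local equation, i.e. the largest `k` such that the ideal of `X` in the local ring of `ℙ^N` at `x`
is contained in the `k`-th power of the maximal ideal. -/
def hypersurfaceMultiplicity {N : ℕ} {X : Scheme.{0}} (ι : X ⟶ ProjSpaceC N) (x : X) : ℕ∞ :=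
  ⨆ (k : ℕ) (_ : RingHom.ker (ι.stalkMap x).hom ≤
    maximalIdeal ((ProjSpaceC N).presheaf.stalk (ι x)) ^ k), (k : ℕ∞)

end

/-!
The multiplicity is read off from Hilbert–Samuel functions. On an affine chart of projective space
around `f y` the data become finite ring homomorphisms `P → A → B`, where `P` is a polynomial ring
in `n + 1` variables over `ℂ`, `A = P ⧸ (G)` with `G` squarefree, `A → B` is injective, and some
`c : A` regular on `B` satisfies `c B ⊆ A` (`IsBirationalMorphism.exists_conductor`). Let `𝔫` be the
maximal ideal of `B` at `y`, and let `e` be the order of `G` at the point below it. If `df_y` has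
rank at most `r = n - i`, coordinates of `P` at this point can be chosen so that all but `r` of them
map into `𝔫 ^ 2` (`exists_submodule_linear_forms`). The dimension of `B ⧸ 𝔫 ^ (2 * j)` is estimated
in two ways.

* From below: this dimension is upper semicontinuous along closed points, since it is the fibre
  dimension of the finite `B`-module of principal parts. Near `𝔫` there are points at which `c` is
  invertible, where `B` agrees with the hypersurface `A`, whose Hilbert–Samuel function is at least
  that of affine `n`-space. So the dimension is at least `(2 * j - 1 + n).choose n`, which grows like
  `2 ^ n * j ^ n / n!` (`MvPolynomial.choose_le_finrank_quotient_pow`).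
* From above: give weight `2` to the coordinates which map into `𝔫 ^ 2` and weight `1` to the
  others, so that polynomials of weight at least `2 * j` map into `𝔫 ^ (2 * j)`. The image of `P` in
  `B ⧸ 𝔫 ^ (2 * j)` is then a quotient of `P` modulo `G` and the polynomials of weight at least
  `2 * j`. The weighted order of `G` is at most `2 * e`, so this quotient has dimension at most the
  number of monomials of weight in `[2 * j - 2 * e, 2 * j)`, which is at most
  `e * 2 ^ r * (j + n).choose n` (`MvPolynomial.weightCount_two_mul_add_le`). The cokernel of `P` in
  `B ⧸ 𝔫 ^ (2 * j)` is generated by a fixed number of elements and killed by `c`, and by the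
  Artin–Rees lemma its dimension is of lower order in `j`
  (`MvPolynomial.exists_finrank_quotient_sup_sup_le`).

Comparing leading terms gives `2 ^ n ≤ e * 2 ^ r`, that is, `2 ^ i ≤ e`
(`MvPolynomial.two_pow_le_order_mul`).
-/

noncomputable section

open MvPolynomial

section Asymptotics

open Filter Topology

/-! ### Ideals of weighted order and counting of monomials -/

theorem tendsto_choose_div_pow (n : ℕ) (φ : ℕ → ℕ) (a : ℝ)
    (hφ : Tendsto φ atTop atTop) (h : Tendsto (fun m : ℕ => (φ m : ℝ) / m) atTop (𝓝 a)) :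
    Tendsto (fun m : ℕ => ((φ m).choose n : ℝ) / (m : ℝ) ^ n) atTop (𝓝 (a ^ n / n.factorial)) := by
  have h1 := (isEquivalent_choose n).comp_tendsto hφ
  have h2 := h1.div (Asymptotics.IsEquivalent.refl (u := fun m : ℕ => (m : ℝ) ^ n))
  refine (h2.symm.tendsto_nhds ?_)
  refine ((h.pow n).div_const (n.factorial : ℝ)).congr fun m => ?_
  simp only [Pi.div_apply, Function.comp_apply]
  rw [div_pow, div_right_comm]

namespace MvPolynomial

variable {σ K : Type*} [Field K]

/-- The ideal of polynomials all of whose monomials have `w`-weight at least `k`. -/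
def weightIdeal (K : Type*) [Field K] (w : σ → ℕ) (k : ℕ) : Ideal (MvPolynomial σ K) where
  carrier := {p | (k : ℕ∞) ≤ (p : MvPowerSeries σ K).weightedOrder w}
  zero_mem' := by simp
  add_mem' {p q} hp hq := by
    rw [Set.mem_ofPred_eq, coe_add]
    exact (le_min hp hq).trans (MvPowerSeries.min_weightedOrder_le_add w)
  smul_mem' p q hq := by
    rw [Set.mem_ofPred_eq, smul_eq_mul, coe_mul, MvPowerSeries.weightedOrder_mul]
    exact le_add_left hq

theorem mem_weightIdeal {w : σ → ℕ} {k : ℕ} {p : MvPolynomial σ K} :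
    p ∈ weightIdeal K w k ↔ (k : ℕ∞) ≤ (p : MvPowerSeries σ K).weightedOrder w :=
  Iff.rfl

theorem mem_weightIdeal_iff_coeff {w : σ → ℕ} {k : ℕ} {p : MvPolynomial σ K} :
    p ∈ weightIdeal K w k ↔ ∀ m, Finsupp.weight w m < k → coeff m p = 0 := by
  rw [mem_weightIdeal]
  constructor
  · intro h m hm
    rw [← coeff_coe]
    exact MvPowerSeries.coeff_eq_zero_of_lt_weightedOrder w
      (lt_of_lt_of_le (by exact_mod_cast hm) h)
  · intro h
    exact MvPowerSeries.nat_le_weightedOrder w fun d hd => by rw [coeff_coe]; exact h d hd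

/-- The order with respect to a weight is additive on products, so dividing by `F` lowers it
by the order of `F`. -/
theorem weightIdeal_colon {w : σ → ℕ} {F : MvPolynomial σ K} {d : ℕ}
    (hF : (F : MvPowerSeries σ K).weightedOrder w = d) (k : ℕ) :
    (weightIdeal K w k).colon {F} = weightIdeal K w (k - d) := by
  ext p
  rw [Submodule.mem_colon_singleton, mem_weightIdeal, mem_weightIdeal, smul_eq_mul, coe_mul,
    MvPowerSeries.weightedOrder_mul, hF, ENat.natCast_sub, tsub_le_iff_right]

theorem weightIdeal_one_eq_pow (k : ℕ) :
    weightIdeal K (1 : σ → ℕ) k = idealOfVars σ K ^ k := by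
  ext p
  rw [mem_weightIdeal_iff_coeff, mem_pow_idealOfVars_iff']
  simp_rw [Finsupp.degree_eq_weight_one]
  rfl

theorem pow_idealOfVars_le_weightIdeal {w : σ → ℕ} (hw : ∀ j, w j ≠ 0) (k : ℕ) :
    idealOfVars σ K ^ k ≤ weightIdeal K w k := by
  rw [← weightIdeal_one_eq_pow]
  intro p hp
  rw [mem_weightIdeal_iff_coeff] at hp ⊢
  refine fun m hm => hp m (lt_of_le_of_lt ?_ hm)
  rw [Finsupp.weight_apply, Finsupp.weight_apply]
  exact Finset.sum_le_sum fun j _ => Nat.mul_le_mul_left _ (Nat.one_le_iff_ne_zero.mpr (hw j))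

/-- The number of monomials of `w`-weight less than `k`. -/
def weightCount (w : σ → ℕ) (k : ℕ) : ℕ := Nat.card {m : σ →₀ ℕ // Finsupp.weight w m < k}

variable [Finite σ]

/-- The coefficients at the monomials of weight less than `k` are coordinates on the quotient. -/
theorem exists_quotient_weightIdeal_equiv (w : σ → ℕ) (hw : ∀ j, w j ≠ 0) (k : ℕ) :
    Nonempty ((MvPolynomial σ K ⧸ weightIdeal K w k) ≃ₗ[K]
      ({m : σ →₀ ℕ // Finsupp.weight w m < k} → K)) := by
  have hfin : Finite {m : σ →₀ ℕ // Finsupp.weight w m < k} :=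
    (Finsupp.finite_of_nat_weight_lt w hw k).to_subtype
  have := Fintype.ofFinite {m : σ →₀ ℕ // Finsupp.weight w m < k}
  let f : MvPolynomial σ K →ₗ[K] ({m : σ →₀ ℕ // Finsupp.weight w m < k} → K) :=
    LinearMap.pi fun m => lcoeff K m.1
  have hker : LinearMap.ker f = (weightIdeal K w k).restrictScalars K := by
    ext p
    rw [Submodule.restrictScalars_mem, mem_weightIdeal_iff_coeff, LinearMap.mem_ker]
    constructor
    · intro h m hm
      exact congrFun h ⟨m, hm⟩
    · intro h
      ext m
      exact h m.1 m.2
  have hsurj : Function.Surjective f := by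
    classical
    intro v
    refine ⟨∑ m, monomial m.1 (v m), ?_⟩
    ext m
    simp [f, coeff_monomial, lcoeff, Subtype.coe_inj]
  exact ⟨((Submodule.Quotient.restrictScalarsEquiv K _).symm.trans
    (Submodule.quotEquivOfEq _ _ hker.symm)).trans (f.quotKerEquivOfSurjective hsurj)⟩

theorem finite_quotient_weightIdeal (w : σ → ℕ) (hw : ∀ j, w j ≠ 0) (k : ℕ) :
    Module.Finite K (MvPolynomial σ K ⧸ weightIdeal K w k) := by
  have hfin : Finite {m : σ →₀ ℕ // Finsupp.weight w m < k} :=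
    (Finsupp.finite_of_nat_weight_lt w hw k).to_subtype
  obtain ⟨e⟩ := exists_quotient_weightIdeal_equiv (K := K) w hw k
  exact Module.Finite.equiv e.symm

theorem finrank_quotient_weightIdeal (w : σ → ℕ) (hw : ∀ j, w j ≠ 0) (k : ℕ) :
    Module.finrank K (MvPolynomial σ K ⧸ weightIdeal K w k) = weightCount w k := by
  have hfin : Finite {m : σ →₀ ℕ // Finsupp.weight w m < k} :=
    (Finsupp.finite_of_nat_weight_lt w hw k).to_subtype
  have := Fintype.ofFinite {m : σ →₀ ℕ // Finsupp.weight w m < k}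
  obtain ⟨e⟩ := exists_quotient_weightIdeal_equiv (K := K) w hw k
  rw [e.finrank_eq, Module.finrank_fintype_fun_eq_card, weightCount, Nat.card_eq_fintype_card]

theorem weightCount_eq_card_add (w : σ → ℕ) (hw : ∀ j, w j ≠ 0) {k l : ℕ} (h : k ≤ l) :
    weightCount w l = weightCount w k +
      {m : σ →₀ ℕ | k ≤ Finsupp.weight w m ∧ Finsupp.weight w m < l}.ncard := by
  have e1 : weightCount w l = {m : σ →₀ ℕ | Finsupp.weight w m < l}.ncard := rfl
  have e2 : weightCount w k = {m : σ →₀ ℕ | Finsupp.weight w m < k}.ncard := rfl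
  rw [e1, e2, ← Set.ncard_union_eq ?_ (Finsupp.finite_of_nat_weight_lt w hw k)
    ((Finsupp.finite_of_nat_weight_lt w hw l).subset fun m hm => hm.2)]
  · congr 1
    ext m
    simp only [Set.mem_ofPred_eq, Set.mem_union]
    omega
  · rw [Set.disjoint_left]
    intro m h1 h2
    simp only [Set.mem_ofPred_eq] at h1 h2
    omega

theorem weightCount_mono (w : σ → ℕ) (hw : ∀ j, w j ≠ 0) : Monotone (weightCount w) :=
  fun _ _ h => by rw [weightCount_eq_card_add w hw h]; omega

theorem ncard_degree_eq (d : ℕ) {n : ℕ} (hn : Nat.card σ = n + 1) :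
    {m : σ →₀ ℕ | Finsupp.degree m = d}.ncard = (d + n).choose n := by
  classical
  have := Fintype.ofFinite σ
  have : {m : σ →₀ ℕ | Finsupp.degree m = d} =
      ((Finset.univ : Finset σ).finsuppAntidiag d : Finset (σ →₀ ℕ)) := by
    ext m
    simp [Finsupp.degree_eq_sum]
  rw [this, Set.ncard_coe_finset, Finset.card_finsuppAntidiag_nat_eq_choose, Finset.card_univ,
    ← Nat.card_eq_fintype_card, hn, show n + 1 + d - 1 = d + n by omega, Nat.choose_symm_add]

theorem weightCount_one_succ {n : ℕ} (hn : Nat.card σ = n + 1) (k : ℕ) :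
    weightCount (1 : σ → ℕ) (k + 1) = weightCount (1 : σ → ℕ) k + (k + n).choose n := by
  rw [weightCount_eq_card_add _ (by simp) (Nat.le_succ k), ← ncard_degree_eq k hn]
  congr 2
  ext m
  simp only [Set.mem_ofPred_eq, Finsupp.degree_eq_weight_one]
  have : Finsupp.weight (1 : σ → ℕ) m = Finsupp.weight (fun _ : σ => 1) m := rfl
  omega

/-- For weights in `{1, 2}`, halving the exponents of the `r` variables of weight one sends the
monomials of weight `2 * d` and `2 * d + 1` to monomials of degree at most `d`; a monomial is
recovered from its image and the set of weight-one variables with odd exponent. For each of the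
`2 ^ r` sets of variables at most one degree occurs. -/
theorem weightCount_two_mul_succ_le {n : ℕ} (hn : Nat.card σ = n + 1) (w : σ → ℕ)
    (hw : ∀ j, w j = 1 ∨ w j = 2) {r : ℕ} (hr : {j | w j = 1}.ncard = r) (d : ℕ) :
    weightCount w (2 * (d + 1)) ≤ weightCount w (2 * d) + 2 ^ r * (d + n).choose n := by
  classical
  have := Fintype.ofFinite σ
  have hw0 : ∀ j, w j ≠ 0 := fun j => by rcases hw j with h | h <;> omega
  rw [weightCount_eq_card_add w hw0 (show 2 * d ≤ 2 * (d + 1) by omega)]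
  refine Nat.add_le_add_left ?_ _
  set S := {m : σ →₀ ℕ | 2 * d ≤ Finsupp.weight w m ∧ Finsupp.weight w m < 2 * (d + 1)} with hS
  have hSfin : S.Finite :=
    (Finsupp.finite_of_nat_weight_lt w hw0 (2 * (d + 1))).subset fun m hm => hm.2
  -- the exponents of weight-one variables are halved, and their parities recorded
  let par : (σ →₀ ℕ) → Finset σ := fun m =>
    Finset.univ.filter fun j => w j = 1 ∧ m j % 2 = 1
  let half : (σ →₀ ℕ) → (σ →₀ ℕ) := fun m =>
    Finsupp.equivFunOnFinite.symm fun j => if w j = 1 then m j / 2 else m j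
  have hweight : ∀ m, Finsupp.weight w m = 2 * (half m).degree + (par m).card := by
    intro m
    rw [Finsupp.weight_apply, Finsupp.sum_fintype _ _ (by simp), Finsupp.degree_eq_sum,
      Finset.card_filter, Finset.mul_sum, ← Finset.sum_add_distrib]
    refine Finset.sum_congr rfl fun j _ => ?_
    simp only [half, Finsupp.equivFunOnFinite_symm_apply_apply, smul_eq_mul]
    rcases hw j with h | h
    · simp only [h, if_true, true_and]
      split_ifs <;> omega
    · simp [h]; omega
  have hinj : ∀ m m', half m = half m' → par m = par m' → m = m' := by
    intro m m' h1 h2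
    ext j
    have h3 := DFunLike.congr_fun h1 j
    have h4 := Finset.ext_iff.mp h2 j
    simp only [half, Finsupp.equivFunOnFinite_symm_apply_apply] at h3
    simp only [par, Finset.mem_filter, Finset.mem_univ, true_and] at h4
    rcases hw j with h | h
    · simp only [h, if_true, true_and] at h3 h4
      omega
    · simpa [h] using h3
  let T : Finset σ := Finset.univ.filter fun j => w j = 1
  have hT : T.card = r := by
    rw [← hr, Set.ncard_eq_toFinset_card']
    congr 1
    ext j; simp [T]
  rw [Set.ncard_eq_toFinset_card S hSfin, ← hT, ← Finset.card_powerset, mul_comm]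
  refine Finset.card_le_mul_card_image_of_maps_to (f := par) (fun m _ => ?_) _ fun ε _ => ?_
  · rw [Finset.mem_powerset]
    intro j hj
    simp only [par, T, Finset.mem_filter] at hj ⊢
    exact ⟨hj.1, hj.2.1⟩
  · calc _ ≤ ((Finset.univ : Finset σ).finsuppAntidiag ((2 * d + 1 - ε.card) / 2)).card := by
          refine Finset.card_le_card_of_injOn half (fun m hm => ?_) fun m hm m' hm' h => ?_
          · simp only [Finset.coe_filter, Set.Finite.mem_toFinset, Set.mem_ofPred_eq, hS] at hm
            have h1 := hweight m
            rw [hm.2] at h1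
            have : (half m).degree = (2 * d + 1 - ε.card) / 2 := by omega
            rw [Finsupp.degree_eq_sum] at this
            simp [this]
          · simp only [Finset.coe_filter, Set.mem_ofPred_eq] at hm hm'
            exact hinj m m' h (hm.2.trans hm'.2.symm)
      _ = ((2 * d + 1 - ε.card) / 2 + n).choose n := by
          rw [Finset.card_finsuppAntidiag_nat_eq_choose, Finset.card_univ,
            ← Nat.card_eq_fintype_card, hn,
            show ∀ d, n + 1 + d - 1 = d + n by intro d; omega, Nat.choose_symm_add]
      _ ≤ _ := Nat.choose_le_choose n (by omega)

theorem weightCount_two_mul_add_le {n : ℕ} (hn : Nat.card σ = n + 1) (w : σ → ℕ)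
    (hw : ∀ j, w j = 1 ∨ w j = 2) {r : ℕ} (hr : {j | w j = 1}.ncard = r) (d e : ℕ) :
    weightCount w (2 * (d + e)) ≤
      weightCount w (2 * d) + e * (2 ^ r * (d + e + n).choose n) := by
  induction e with
  | zero => simp
  | succ e ih =>
    refine (weightCount_two_mul_succ_le hn w hw hr (d + e)).trans ?_
    have h1 : (d + e + n).choose n ≤ (d + (e + 1) + n).choose n :=
      Nat.choose_le_choose n (by omega)
    calc _ ≤ weightCount w (2 * d) + e * (2 ^ r * (d + e + n).choose n)
          + 2 ^ r * (d + e + n).choose n := Nat.add_le_add_right ih _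
      _ ≤ weightCount w (2 * d) + e * (2 ^ r * (d + (e + 1) + n).choose n)
          + 2 ^ r * (d + (e + 1) + n).choose n := by gcongr
      _ = _ := by ring

/-- The leading term of the colength of the `φ m`-th power of the maximal ideal at a point of
multiplicity `e` of a hypersurface of dimension `n`, when `φ m` grows like `a * m`. -/
theorem tendsto_weightCount_sub {n : ℕ} (hn : Nat.card σ = n + 1) (e : ℕ) (φ : ℕ → ℕ) (a : ℝ)
    (hφ : Tendsto φ atTop atTop) (h : Tendsto (fun m : ℕ => (φ m : ℝ) / m) atTop (𝓝 a)) :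
    Tendsto (fun m : ℕ => ((weightCount (1 : σ → ℕ) (φ m) : ℝ) -
      weightCount (1 : σ → ℕ) (φ m - e)) / (m : ℝ) ^ n) atTop (𝓝 (e * (a ^ n / n.factorial))) := by
  induction e with
  | zero => simp
  | succ e ih =>
    have h1 : Tendsto (fun m => φ m - (e + 1) + n) atTop atTop :=
      tendsto_atTop_mono (fun m => Nat.le_add_right _ n) ((tendsto_sub_atTop_nat (e + 1)).comp hφ)
    have hge : ∀ᶠ m in atTop, e + 1 ≤ φ m := hφ.eventually_ge_atTop (e + 1)
    have h2 : Tendsto (fun m => ((φ m - (e + 1) + n : ℕ) : ℝ) / m) atTop (𝓝 a) := by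
      have h3 : Tendsto (fun m : ℕ => ((n : ℝ) - (e + 1)) / m) atTop (𝓝 0) :=
        tendsto_const_div_atTop_nhds_zero_nat _
      have h4 := h.add h3
      rw [add_zero] at h4
      refine h4.congr' ?_
      filter_upwards [hge] with m hm
      push_cast [Nat.cast_sub hm]
      ring
    have h5 := ih.add (tendsto_choose_div_pow n _ a h1 h2)
    have h6 : (((e + 1 : ℕ) : ℝ) * (a ^ n / n.factorial)) =
      e * (a ^ n / n.factorial) + a ^ n / n.factorial := by push_cast; ring
    rw [h6]
    refine h5.congr' ?_
    filter_upwards [hge] with m hm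
    have h7 := weightCount_one_succ hn (φ m - (e + 1))
    rw [show φ m - (e + 1) + 1 = φ m - e by omega] at h7
    rw [h7]
    push_cast
    ring

end MvPolynomial

/-! ### Colengths of ideals -/

section Colength

variable {K P : Type*} [Field K] [CommRing P] [Algebra K P]

/-- Additivity of the dimension in the exact sequence
`0 → P ⧸ (W : a) → P ⧸ W → P ⧸ (W + (a)) → 0`, whose first map is multiplication by `a`. -/
theorem finrank_quotient_sup_span_add_colon (W : Ideal P) (a : P) [Module.Finite K (P ⧸ W)] :
    Module.finrank K (P ⧸ (W ⊔ Ideal.span {a})) + Module.finrank K (P ⧸ W.colon {a}) =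
      Module.finrank K (P ⧸ W) := by
  let g : (P ⧸ W) →ₗ[K] (P ⧸ (W ⊔ Ideal.span {a})) :=
    (Ideal.Quotient.factorₐ K (le_sup_left : W ≤ W ⊔ Ideal.span {a})).toLinearMap
  have hg : Function.Surjective g :=
    Ideal.Quotient.factor_surjective (le_sup_left : W ≤ W ⊔ Ideal.span {a})
  have hle : ((W.colon {a} : Ideal P)).restrictScalars K ≤
      LinearMap.ker ((W.mkQ.restrictScalars K) ∘ₗ (LinearMap.mulRight K a)) := by
    intro p hp
    rw [Submodule.restrictScalars_mem, Submodule.mem_colon_singleton] at hp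
    simpa using (Submodule.Quotient.mk_eq_zero W).mpr hp
  let f : (P ⧸ (W.colon {a} : Ideal P)) →ₗ[K] (P ⧸ W) :=
    (Submodule.liftQ _ ((W.mkQ.restrictScalars K) ∘ₗ (LinearMap.mulRight K a)) hle) ∘ₗ
      (Submodule.Quotient.restrictScalarsEquiv K (W.colon {a} : Ideal P)).symm.toLinearMap
  have hfmk : ∀ p : P, f (Ideal.Quotient.mk _ p) = Ideal.Quotient.mk W (p * a) := fun p => rfl
  have hgmk : ∀ p : P, g (Ideal.Quotient.mk _ p) = Ideal.Quotient.mk _ p := fun p => rfl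
  have hf : Function.Injective f := by
    rw [injective_iff_map_eq_zero]
    intro x hx
    obtain ⟨p, rfl⟩ := Ideal.Quotient.mk_surjective x
    rw [hfmk, Ideal.Quotient.eq_zero_iff_mem] at hx
    rw [Ideal.Quotient.eq_zero_iff_mem, Submodule.mem_colon_singleton]
    exact hx
  have hrange : LinearMap.range f = LinearMap.ker g := by
    ext x
    obtain ⟨p, rfl⟩ := Ideal.Quotient.mk_surjective x
    rw [LinearMap.mem_ker, hgmk, Ideal.Quotient.eq_zero_iff_mem, LinearMap.mem_range]
    constructor
    · rintro ⟨y, hy⟩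
      obtain ⟨q, rfl⟩ := Ideal.Quotient.mk_surjective y
      rw [hfmk, Ideal.Quotient.mk_eq_mk_iff_sub_mem] at hy
      have : p = -(q * a - p) + q * a := by ring
      rw [this]
      exact add_mem (Ideal.mem_sup_left (neg_mem hy))
        (Ideal.mem_sup_right (Ideal.mul_mem_left _ _ (Ideal.mem_span_singleton_self a)))
    · intro h
      obtain ⟨u, hu, v, hv, rfl⟩ := Submodule.mem_sup.mp h
      obtain ⟨q, rfl⟩ := Ideal.mem_span_singleton'.mp hv
      refine ⟨Ideal.Quotient.mk _ q, ?_⟩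
      rw [hfmk, Ideal.Quotient.mk_eq_mk_iff_sub_mem]
      simpa using neg_mem hu
  have h1 := LinearMap.finrank_range_add_finrank_ker g
  rw [LinearMap.range_eq_top.mpr hg, finrank_top, ← hrange, LinearMap.finrank_range_of_inj hf] at h1
  exact h1

theorem finite_quotient_of_le {I J : Ideal P} (h : I ≤ J) [Module.Finite K (P ⧸ I)] :
    Module.Finite K (P ⧸ J) :=
  Module.Finite.of_surjective (Ideal.Quotient.factorₐ K h).toLinearMap
    (Ideal.Quotient.factor_surjective h)

theorem finrank_quotient_le_of_le {I J : Ideal P} (h : I ≤ J) [Module.Finite K (P ⧸ I)] :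
    Module.finrank K (P ⧸ J) ≤ Module.finrank K (P ⧸ I) :=
  LinearMap.finrank_le_finrank_of_surjective (f := (Ideal.Quotient.factorₐ K h).toLinearMap)
    (Ideal.Quotient.factor_surjective h)

/-- If `c • D` lies in the cyclic submodule generated by `x`, then `D` is at most as large as a
quotient of `P` together with `s` quotients of `P ⧸ (c)`. -/
theorem finrank_le_of_smul_mem_span {D : Type*} [AddCommGroup D] [Module P D] [Module K D]
    [IsScalarTower K P D] (J : Ideal P) (hJ : ∀ a ∈ J, ∀ x : D, a • x = 0)
    [Module.Finite K (P ⧸ J)] (c : P) (x : D)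
    (hc : ∀ z : D, c • z ∈ Submodule.span P {x}) {s : ℕ} (b : Fin s → D)
    (hb : Submodule.span P (Set.range b) = ⊤) :
    Module.Finite K D ∧ Module.finrank K D ≤
      Module.finrank K (P ⧸ J) + s * Module.finrank K (P ⧸ (J ⊔ Ideal.span {c})) := by
  have := finite_quotient_of_le (K := K) (le_sup_left : J ≤ J ⊔ Ideal.span {c})
  let E := Submodule.span P {x}
  -- the cyclic submodule is a quotient of `P ⧸ J`
  let f0 : (P ⧸ J) →ₗ[P] D := Submodule.liftQ J (LinearMap.toSpanSingleton P D x)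
    fun a ha => hJ a ha x
  -- and the quotient by it is a quotient of `(P ⧸ (J, c)) ^ s`
  have hkill : ∀ a ∈ J ⊔ Ideal.span {c}, ∀ z : D ⧸ E, a • z = 0 := by
    intro a ha z
    obtain ⟨z, rfl⟩ := Submodule.Quotient.mk_surjective _ z
    obtain ⟨u, hu, v, hv, rfl⟩ := Submodule.mem_sup.mp ha
    obtain ⟨q, rfl⟩ := Ideal.mem_span_singleton'.mp hv
    rw [← Submodule.Quotient.mk_smul, Submodule.Quotient.mk_eq_zero, add_smul, hJ u hu, zero_add,
      mul_smul]
    exact E.smul_mem _ (hc z)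
  let g0 : (Fin s → (P ⧸ (J ⊔ Ideal.span {c}))) →ₗ[P] (D ⧸ E) :=
    LinearMap.lsum P _ P fun j => Submodule.liftQ (J ⊔ Ideal.span {c})
      (LinearMap.toSpanSingleton P (D ⧸ E) (Submodule.Quotient.mk (b j)))
      fun a ha => hkill a ha _
  have hg0 : Function.Surjective g0 := by
    rw [← LinearMap.range_eq_top, eq_top_iff]
    have h1 : (⊤ : Submodule P (D ⧸ E)) = Submodule.map E.mkQ ⊤ := by
      rw [Submodule.map_top, Submodule.range_mkQ]
    rw [h1, ← hb, Submodule.map_span, Submodule.span_le]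
    rintro _ ⟨_, ⟨j, rfl⟩, rfl⟩
    refine ⟨Pi.single j (Submodule.Quotient.mk 1), ?_⟩
    simp only [g0, LinearMap.lsum_apply, LinearMap.sum_apply, LinearMap.comp_apply,
      LinearMap.proj_apply]
    rw [Finset.sum_eq_single j]
    · rw [Pi.single_eq_same]
      exact (Submodule.liftQ_apply _ _ _).trans (one_smul _ _)
    · intro i _ hi
      rw [Pi.single_eq_of_ne hi, map_zero]
    · simp
  have hf0 : LinearMap.range f0 = E := by
    ext z
    simp only [E, Submodule.mem_span_singleton, LinearMap.mem_range]
    constructor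
    · rintro ⟨y, rfl⟩
      obtain ⟨q, rfl⟩ := Submodule.Quotient.mk_surjective _ y
      exact ⟨q, rfl⟩
    · rintro ⟨q, rfl⟩
      exact ⟨Submodule.Quotient.mk q, rfl⟩
  let EK := E.restrictScalars K
  have hEK : LinearMap.range (f0.restrictScalars K) = EK := by
    rw [LinearMap.range_restrictScalars, hf0]
  have finE : Module.Finite K EK := by rw [← hEK]; infer_instance
  let gK : (Fin s → (P ⧸ (J ⊔ Ideal.span {c}))) →ₗ[K] (D ⧸ EK) :=
    (Submodule.Quotient.restrictScalarsEquiv K E).symm.toLinearMap ∘ₗ g0.restrictScalars K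
  have hgK : Function.Surjective gK :=
    (Submodule.Quotient.restrictScalarsEquiv K E).symm.surjective.comp hg0
  have finQ : Module.Finite K (D ⧸ EK) := Module.Finite.of_surjective gK hgK
  have finD : Module.Finite K D := Module.Finite.of_submodule_quotient EK
  refine ⟨finD, ?_⟩
  rw [← Submodule.finrank_quotient_add_finrank EK, add_comm]
  refine add_le_add ?_ ?_
  · rw [← hEK]
    exact LinearMap.finrank_range_le _
  · refine (LinearMap.finrank_le_finrank_of_surjective hgK).trans ?_
    rw [Module.finrank_pi_fintype]
    simp

end Colength

namespace MvPolynomial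

variable {σ K : Type*} [Field K] [Finite σ]

/-- The weighted Hilbert–Samuel function of a hypersurface depends only on the weighted order of
its equation. -/
theorem finrank_quotient_weightIdeal_sup_span {w : σ → ℕ} (hw : ∀ j, w j ≠ 0)
    {F : MvPolynomial σ K} {d : ℕ} (hF : (F : MvPowerSeries σ K).weightedOrder w = d) (k : ℕ) :
    Module.finrank K (MvPolynomial σ K ⧸ (weightIdeal K w k ⊔ Ideal.span {F})) +
      weightCount w (k - d) = weightCount w k := by
  have := finite_quotient_weightIdeal (K := K) w hw k
  rw [← finrank_quotient_weightIdeal (K := K) w hw k,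
    ← finrank_quotient_weightIdeal (K := K) w hw (k - d),
    ← finrank_quotient_sup_span_add_colon (weightIdeal K w k) F, weightIdeal_colon hF]

/-- By Artin–Rees, cutting `P ⧸ (F)` by a nonzerodivisor `c` costs a bounded shift in the colength
of the powers of the maximal ideal. -/
theorem exists_finrank_quotient_sup_sup_le (F c : MvPolynomial σ K)
    (hc : ∀ p, F ∣ c * p → F ∣ p) :
    ∃ t, ∀ k, t ≤ k → Module.finrank K
        (MvPolynomial σ K ⧸ (idealOfVars σ K ^ k ⊔ Ideal.span {F} ⊔ Ideal.span {c})) +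
      Module.finrank K (MvPolynomial σ K ⧸ (idealOfVars σ K ^ (k - t) ⊔ Ideal.span {F})) ≤
      Module.finrank K (MvPolynomial σ K ⧸ (idealOfVars σ K ^ k ⊔ Ideal.span {F})) := by
  let P := MvPolynomial σ K
  let m := idealOfVars σ K
  let A := P ⧸ Ideal.span {F}
  have key : ∀ k (p : P), p ∈ m ^ k ⊔ Ideal.span {F} ↔
      (Submodule.Quotient.mk p : A) ∈ m ^ k • (⊤ : Submodule P A) := by
    intro k p
    rw [show (⊤ : Submodule P A) = Submodule.map (Submodule.mkQ (Ideal.span {F})) ⊤ by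
      rw [Submodule.map_top, Submodule.range_mkQ], ← Submodule.map_smul'', smul_eq_mul,
      Ideal.mul_top]
    constructor
    · intro h
      obtain ⟨u, hu, v, hv, rfl⟩ := Submodule.mem_sup.mp h
      refine ⟨u, hu, ?_⟩
      rw [Submodule.mkQ_apply, Submodule.Quotient.eq]
      simpa using hv
    · rintro ⟨u, hu, h⟩
      rw [Submodule.mkQ_apply, Submodule.Quotient.eq] at h
      rw [show p = u + -(u - p) by ring]
      exact add_mem (Ideal.mem_sup_left hu) (Ideal.mem_sup_right (neg_mem h))
  obtain ⟨t, ht⟩ := Ideal.exists_pow_inf_eq_pow_smul m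
    (Submodule.span P {(Submodule.Quotient.mk c : A)})
  refine ⟨t, fun k hk => ?_⟩
  have hfin : ∀ l, Module.Finite K (P ⧸ (m ^ l ⊔ Ideal.span {F})) := by
    intro l
    have := finite_quotient_weightIdeal (σ := σ) (K := K) 1 (by simp) l
    rw [weightIdeal_one_eq_pow] at this
    exact finite_quotient_of_le (le_sup_left : m ^ l ≤ _)
  have := hfin k
  have := hfin (k - t)
  rw [← finrank_quotient_sup_span_add_colon (m ^ k ⊔ Ideal.span {F}) c]
  have hcol : m ^ (k - t) ⊔ Ideal.span {F} ≥ (m ^ k ⊔ Ideal.span {F}).colon {c} := by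
    intro p hp
    rw [Submodule.mem_colon_singleton, smul_eq_mul, key] at hp
    have h1 : (Submodule.Quotient.mk (p * c) : A) ∈
        m ^ k • (⊤ : Submodule P A) ⊓ Submodule.span P {(Submodule.Quotient.mk c : A)} :=
      ⟨hp, Submodule.mem_span_singleton.mpr ⟨p, rfl⟩⟩
    rw [ht k hk] at h1
    have h2 := smul_mono_right (m ^ (k - t)) (inf_le_right :
      m ^ t • (⊤ : Submodule P A) ⊓ Submodule.span P {(Submodule.Quotient.mk c : A)} ≤ _) h1
    obtain ⟨q, hq, h3⟩ := Submodule.mem_smul_span_singleton.mp h2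
    rw [← Submodule.Quotient.mk_smul, Submodule.Quotient.eq, Ideal.mem_span_singleton, smul_eq_mul,
      ← sub_mul, mul_comm] at h3
    rw [show p = q + -(q - p) by ring]
    exact add_mem (Ideal.mem_sup_left hq) (Ideal.mem_sup_right
      (neg_mem (Ideal.mem_span_singleton.mpr (hc _ h3))))
  have hfc : Module.Finite K (P ⧸ (m ^ k ⊔ Ideal.span {F}).colon {c}) :=
    finite_quotient_of_le (Ideal.le_colon : (m ^ k ⊔ Ideal.span {F}) ≤ _)
  exact Nat.add_le_add_left (finrank_quotient_le_of_le hcol) _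

end MvPolynomial

/-! ### Semicontinuity of colengths and the lower bound -/

section Semicontinuity

open TensorProduct

variable {K B : Type*} [Field K] [CommRing B] [Algebra K B]

/-- The algebra `(B ⊗ B) ⧸ I ^ k` of principal parts, `I` being the ideal of the diagonal, is a
finite module over the left factor. -/
theorem finite_quotient_kaehlerIdeal_pow [Algebra.FiniteType K B] (k : ℕ) (hk : k ≠ 0) :
    Module.Finite B ((B ⊗[K] B) ⧸ KaehlerDifferential.ideal K B ^ k) := by
  set I := KaehlerDifferential.ideal K B with hI
  have hker : RingHom.ker (Algebra.TensorProduct.lmul'' K (S := B)) = I := rfl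
  let f : ((B ⊗[K] B) ⧸ I ^ k) →ₐ[B] B := Ideal.Quotient.liftₐ (I ^ k)
    (Algebra.TensorProduct.lmul'' K) fun a ha => by
      have : a ∈ I := Ideal.pow_le_self hk ha
      rwa [← hker, RingHom.mem_ker] at this
  have hfker : RingHom.ker f = I.map (Ideal.Quotient.mk (I ^ k)) := by
    ext x
    obtain ⟨x, rfl⟩ := Ideal.Quotient.mk_surjective x
    rw [RingHom.mem_ker, Ideal.mem_quotient_iff_mem (Ideal.pow_le_self hk)]
    exact Iff.rfl
  refine Module.finite_of_surjective_of_ker_le_nilradical f (fun b => ?_) ?_ ?_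
  · exact ⟨algebraMap B _ b, f.commutes b⟩
  · rw [hfker]
    intro x hx
    refine mem_nilradical.mpr ⟨k, ?_⟩
    have := Ideal.pow_mem_pow hx k
    rwa [← Ideal.map_pow, Ideal.map_quotient_self, Ideal.mem_bot] at this
  · rw [hfker]
    exact (KaehlerDifferential.ideal_fg K B).map _

theorem Ideal.sup_pow_le_sup_pow_right {R : Type*} [CommRing R] (I J : Ideal R) (k : ℕ) :
    (I ⊔ J) ^ k ≤ I ⊔ J ^ k := by
  induction k with
  | zero => simp
  | succ k ih =>
    rw [pow_succ, pow_succ, Ideal.mul_le]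
    intro x hx y hy
    obtain ⟨a, ha, b, hb, rfl⟩ := Submodule.mem_sup.mp (ih hx)
    obtain ⟨c, hc, d, hd, rfl⟩ := Submodule.mem_sup.mp hy
    rw [show (a + b) * (c + d) = (a * (c + d) + b * c) + b * d by ring]
    exact add_mem (Ideal.mem_sup_left (add_mem (Ideal.mul_mem_right _ _ ha)
      (Ideal.mul_mem_left _ _ hc))) (Ideal.mem_sup_right (Ideal.mul_mem_mul hb hd))

/-- Upper semicontinuity of the colength of the `k`-th power of a `K`-rational maximal ideal: a
family spanning `B ⧸ 𝔫 ^ k` spans `B ⧸ 𝔫' ^ k` for all `𝔫'` in a neighbourhood of `𝔫`. It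
follows from Nakayama's lemma for the algebra of principal parts, whose fibre at `𝔫` is
`B ⧸ 𝔫 ^ k`. -/
theorem exists_notMem_forall_span_quotient_pow_eq_top [Algebra.FiniteType K B] (𝔫 : Ideal B)
    (h𝔫 : 𝔫 ≠ ⊤) (k : ℕ) {d : ℕ} (b : Fin d → B)
    (hb : Submodule.span K (Set.range fun j => Ideal.Quotient.mk (𝔫 ^ k) (b j)) = ⊤) :
    ∃ g, g ∉ 𝔫 ∧ ∀ 𝔫' : Ideal B, g ∉ 𝔫' → Function.Bijective (algebraMap K (B ⧸ 𝔫')) →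
      Submodule.span K (Set.range fun j => Ideal.Quotient.mk (𝔫' ^ k) (b j)) = ⊤ := by
  rcases Nat.eq_zero_or_pos k with rfl | hk
  · refine ⟨1, (Ideal.ne_top_iff_one 𝔫).mp h𝔫, fun 𝔫' _ _ => ?_⟩
    have : Subsingleton (B ⧸ 𝔫' ^ 0) := by
      rw [pow_zero, Ideal.one_eq_top]; infer_instance
    exact Subsingleton.elim _ _
  set I := KaehlerDifferential.ideal K B with hI
  have hMfin : Module.Finite B ((B ⊗[K] B) ⧸ I ^ k) := finite_quotient_kaehlerIdeal_pow k hk.ne'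
  let q : (B ⊗[K] B) →ₐ[B] ((B ⊗[K] B) ⧸ I ^ k) := Ideal.Quotient.mkₐ B (I ^ k)
  let N : Submodule B ((B ⊗[K] B) ⧸ I ^ k) := Submodule.span B (Set.range fun j => q (1 ⊗ₜ b j))
  have hNtop : (⊤ : Submodule B ((B ⊗[K] B) ⧸ I ^ k)) ≤ N ⊔ 𝔫 • ⊤ := by
    have hright : ∀ z : B, q (1 ⊗ₜ z) ∈ N ⊔ 𝔫 • (⊤ : Submodule B ((B ⊗[K] B) ⧸ I ^ k)) := by
      intro z
      have hz : Ideal.Quotient.mk (𝔫 ^ k) z ∈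
          Submodule.span K (Set.range fun j => Ideal.Quotient.mk (𝔫 ^ k) (b j)) := by
        rw [hb]; trivial
      obtain ⟨l, hl⟩ := (Submodule.mem_span_range_iff_exists_fun K).mp hz
      have hν : z - ∑ j, l j • b j ∈ 𝔫 ^ k := by
        rw [← Ideal.Quotient.eq_zero_iff_mem, map_sub, map_sum, ← hl, sub_eq_zero]
        rfl
      have h1 : (1 : B) ⊗ₜ[K] z = ∑ j, l j • ((1 : B) ⊗ₜ[K] b j) +
          (1 : B) ⊗ₜ[K] (z - ∑ j, l j • b j) := by
        simp [TensorProduct.tmul_sub, TensorProduct.tmul_sum, TensorProduct.tmul_smul]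
      have hincl : (𝔫.map (Algebra.TensorProduct.includeRight : B →ₐ[K] B ⊗[K] B)) ≤
          𝔫.map (algebraMap B (B ⊗[K] B)) ⊔ I := by
        rw [Ideal.map_le_iff_le_comap]
        intro ν hν
        have h2 : (1 : B) ⊗ₜ[K] ν = ν ⊗ₜ[K] (1 : B) + ((1 : B) ⊗ₜ[K] ν - ν ⊗ₜ[K] (1 : B)) := by
          ring
        change (1 : B) ⊗ₜ[K] ν ∈ 𝔫.map (algebraMap B (B ⊗[K] B)) ⊔ I
        rw [h2]
        exact add_mem (Ideal.mem_sup_left (Ideal.mem_map_of_mem _ hν))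
          (Ideal.mem_sup_right (KaehlerDifferential.one_smul_sub_smul_one_mem_ideal K ν))
      have h3 : (1 : B) ⊗ₜ[K] (z - ∑ j, l j • b j) ∈
          𝔫.map (algebraMap B (B ⊗[K] B)) ⊔ I ^ k := by
        refine Ideal.sup_pow_le_sup_pow_right _ _ k (Ideal.pow_right_mono hincl k ?_)
        rw [← Ideal.map_pow]
        exact Ideal.mem_map_of_mem (Algebra.TensorProduct.includeRight : B →ₐ[K] B ⊗[K] B) hν
      rw [h1, map_add, map_sum]
      refine add_mem (Submodule.mem_sup_left (Submodule.sum_mem _ fun j _ => ?_))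
        (Submodule.mem_sup_right ?_)
      · have h4 : l j • ((1 : B) ⊗ₜ[K] b j) = algebraMap K B (l j) • ((1 : B) ⊗ₜ[K] b j) :=
          (algebraMap_smul B (l j) _).symm
        rw [h4, map_smul]
        exact N.smul_mem _ (Submodule.subset_span ⟨j, rfl⟩)
      · obtain ⟨u, hu, v, hv, huv⟩ := Submodule.mem_sup.mp h3
        have h5 : q v = 0 := Ideal.Quotient.eq_zero_iff_mem.mpr hv
        rw [← huv, map_add, h5, add_zero, Ideal.smul_top_eq_map, Submodule.restrictScalars_mem]
        have h6 := Ideal.mem_map_of_mem (q : (B ⊗[K] B) →+* ((B ⊗[K] B) ⧸ I ^ k)) hu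
        rw [Ideal.map_map] at h6
        exact h6
    intro x _
    obtain ⟨x, rfl⟩ := Ideal.Quotient.mk_surjective x
    change q x ∈ _
    induction x using TensorProduct.induction_on with
    | zero => rw [map_zero]; exact zero_mem _
    | add x y hx hy => rw [map_add]; exact add_mem (hx trivial) (hy trivial)
    | tmul x y =>
      have h1 : x ⊗ₜ[K] y = x • ((1 : B) ⊗ₜ[K] y) := by
        rw [TensorProduct.smul_tmul', smul_eq_mul, mul_one]
      rw [h1, map_smul]
      exact Submodule.smul_mem _ _ (hright y)
  obtain ⟨g, hg1, hg⟩ := Submodule.exists_sub_one_mem_and_smul_eq_zero_of_fg_of_le_smul 𝔫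
    (⊤ : Submodule B (((B ⊗[K] B) ⧸ I ^ k) ⧸ N)) Module.Finite.fg_top (by
      rw [← Submodule.range_mkQ N, ← Submodule.map_top, ← Submodule.map_smul'']
      refine (Submodule.map_mono hNtop).trans ?_
      rw [Submodule.map_sup, Submodule.mkQ_map_self, bot_sup_eq])
  have hgN : ∀ x : (B ⊗[K] B) ⧸ I ^ k, g • x ∈ N := fun x => by
    have := hg (N.mkQ x) trivial
    rwa [← map_smul, Submodule.mkQ_apply, Submodule.Quotient.mk_eq_zero] at this
  refine ⟨g, fun h => h𝔫 ((Ideal.eq_top_iff_one _).mpr ?_), fun 𝔫' hg' hbij => ?_⟩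
  · simpa using sub_mem h hg1
  -- evaluate the left factor at the rational point `𝔫'`
  let ev : B →ₐ[K] K := (AlgEquiv.ofBijective (Algebra.ofId K (B ⧸ 𝔫')) hbij).symm.toAlgHom.comp
    (Ideal.Quotient.mkₐ K 𝔫')
  have hev : ∀ z, algebraMap K (B ⧸ 𝔫') (ev z) = Ideal.Quotient.mk 𝔫' z := fun z =>
    (AlgEquiv.ofBijective (Algebra.ofId K (B ⧸ 𝔫')) hbij).apply_symm_apply _
  let Φ : B ⊗[K] B →ₐ[K] (B ⧸ 𝔫' ^ k) := Algebra.TensorProduct.lift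
    ((Algebra.ofId K (B ⧸ 𝔫' ^ k)).comp ev) (Ideal.Quotient.mkₐ K (𝔫' ^ k))
    fun _ _ => Commute.all _ _
  have hΦ : ∀ x y, Φ (x ⊗ₜ y) = ev x • Ideal.Quotient.mk (𝔫' ^ k) y := fun x y => by
    rw [Algebra.smul_def]; exact Algebra.TensorProduct.lift_tmul _ _ _ _ _
  have hΦI : I ≤ (𝔫'.map (Ideal.Quotient.mk (𝔫' ^ k))).comap Φ := by
    rw [hI, ← KaehlerDifferential.span_range_eq_ideal, Ideal.span_le]
    rintro _ ⟨z, rfl⟩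
    have h1 : Φ (1 ⊗ₜ z - z ⊗ₜ 1) =
        Ideal.Quotient.mk (𝔫' ^ k) (z - algebraMap K B (ev z)) := by
      rw [map_sub, hΦ, hΦ, map_one, one_smul, map_one, map_sub, Algebra.smul_def, mul_one]
      rfl
    change Φ (1 ⊗ₜ z - z ⊗ₜ 1) ∈ 𝔫'.map (Ideal.Quotient.mk (𝔫' ^ k))
    rw [h1]
    refine Ideal.mem_map_of_mem _ ?_
    rw [← Ideal.Quotient.eq_zero_iff_mem, map_sub, sub_eq_zero]
    exact (hev z).symm
  have hΦk : ∀ x ∈ I ^ k, Φ x = 0 := by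
    intro x hx
    have h1 := Ideal.pow_right_mono hΦI k hx
    have h2 := Ideal.le_comap_pow (f := (Φ : B ⊗[K] B →+* (B ⧸ 𝔫' ^ k)))
      (K := 𝔫'.map (Ideal.Quotient.mk (𝔫' ^ k))) k h1
    rw [Ideal.mem_comap, ← Ideal.map_pow, Ideal.map_quotient_self, Ideal.mem_bot] at h2
    exact h2
  have hmem : ∀ x : B ⊗[K] B, q x ∈ N → Φ x ∈
      Submodule.span K (Set.range fun j => Ideal.Quotient.mk (𝔫' ^ k) (b j)) := by
    intro x hx
    obtain ⟨β, hβ⟩ := (Submodule.mem_span_range_iff_exists_fun B).mp hx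
    have h1 : ∑ j, β j ⊗ₜ b j - x ∈ I ^ k := by
      rw [← Ideal.Quotient.eq_zero_iff_mem]
      change q _ = 0
      rw [map_sub, ← hβ, map_sum, sub_eq_zero]
      refine Finset.sum_congr rfl fun j _ => ?_
      rw [← map_smul, TensorProduct.smul_tmul', smul_eq_mul, mul_one]
    have h2 := hΦk _ h1
    rw [map_sub, sub_eq_zero] at h2
    rw [← h2, map_sum]
    refine Submodule.sum_mem _ fun j _ => ?_
    rw [hΦ]
    exact Submodule.smul_mem _ _ (Submodule.subset_span ⟨j, rfl⟩)
  have hevg : ev g ≠ 0 := by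
    intro h
    apply hg'
    rw [← Ideal.Quotient.eq_zero_iff_mem, ← hev, h, map_zero]
  rw [eq_top_iff]
  intro x _
  obtain ⟨z, rfl⟩ := Ideal.Quotient.mk_surjective x
  have h1 := hmem (g ⊗ₜ z) (by
    have := hgN (q (1 ⊗ₜ z))
    rwa [← map_smul, TensorProduct.smul_tmul', smul_eq_mul, mul_one] at this)
  rw [hΦ] at h1
  exact (Submodule.smul_mem_iff _ hevg).mp h1

end Semicontinuity

section RationalPoint

variable {K : Type*} [Field K]

/-- Zariski's lemma over an algebraically closed field. -/
theorem bijective_algebraMap_quotient_of_isMaximal [IsAlgClosed K] {B : Type*} [CommRing B]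
    [Algebra K B] [Algebra.FiniteType K B] (𝔫 : Ideal B) [𝔫.IsMaximal] :
    Function.Bijective (algebraMap K (B ⧸ 𝔫)) := by
  let := Ideal.Quotient.field 𝔫
  have : Algebra.FiniteType K (B ⧸ 𝔫) := inferInstance
  have : Module.Finite K (B ⧸ 𝔫) := finite_of_finite_type_of_isJacobsonRing K (B ⧸ 𝔫)
  exact IsAlgClosed.algebraMap_bijective_of_isIntegral

/-- If `c • B` lies in the image of `φ : P → B`, then away from `c` the map
`P → B ⧸ 𝔫 ^ k` has kernel `𝔪 ^ k + ker φ`. -/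
theorem mem_pow_sup_of_map_mem_pow {P B : Type*} [CommRing P] [CommRing B] (φ : P →+* B) (c : P)
    (hc : ∀ b, ∃ p, φ c * b = φ p) (J : Ideal P) (hJ : RingHom.ker φ ≤ J) (𝔫 : Ideal B)
    [hm : (𝔫.comap φ).IsMaximal] (hcn : φ c ∉ 𝔫) (k : ℕ) (p : P) (hp : φ p ∈ 𝔫 ^ k) :
    p ∈ 𝔫.comap φ ^ k ⊔ J := by
  -- multiplied by a power of `φ c`, an element of `𝔫 ^ k` comes from the `k`-th power below
  have key : ∀ k, ∀ x ∈ 𝔫 ^ k, ∃ q ∈ 𝔫.comap φ ^ k, φ c ^ (k + 1) * x = φ q := by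
    intro k
    induction k with
    | zero =>
      intro x _
      obtain ⟨q, hq⟩ := hc x
      exact ⟨q, by simp, by simpa using hq⟩
    | succ k ih =>
      intro x hx
      rw [pow_succ] at hx
      induction hx using Submodule.mul_induction_on' with
      | mem_mul_mem x hx ν hν =>
        obtain ⟨q1, hq1, h1⟩ := ih x hx
        obtain ⟨q2, h2⟩ := hc ν
        refine ⟨q1 * q2, ?_, ?_⟩
        · rw [pow_succ]
          refine Ideal.mul_mem_mul hq1 ?_
          rw [Ideal.mem_comap, ← h2]
          exact Ideal.mul_mem_left _ _ hν
        · rw [map_mul, ← h1, ← h2]; ring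
      | add x _ y _ hx hy =>
        obtain ⟨q1, hq1, h1⟩ := hx
        obtain ⟨q2, hq2, h2⟩ := hy
        exact ⟨q1 + q2, add_mem hq1 hq2, by rw [mul_add, h1, h2, map_add]⟩
  obtain ⟨q, hq, h⟩ := key k _ hp
  have h1 : c ^ (k + 1) * p ∈ 𝔫.comap φ ^ k ⊔ J := by
    have h2 : c ^ (k + 1) * p - q ∈ RingHom.ker φ := by
      rw [RingHom.mem_ker, map_sub, map_mul, map_pow, h, sub_self]
    rw [show c ^ (k + 1) * p = q + (c ^ (k + 1) * p - q) by ring]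
    exact add_mem (Ideal.mem_sup_left hq) (Ideal.mem_sup_right (hJ h2))
  have h3 : Ideal.span {c} ⊔ 𝔫.comap φ = ⊤ := by
    rw [sup_comm]
    exact hm.out.2 _ (lt_of_le_of_ne le_sup_left fun h => hcn (by
      have : c ∈ 𝔫.comap φ := by
        rw [h]; exact Ideal.mem_sup_right (Ideal.mem_span_singleton_self c)
      exact this))
  have h4 := Ideal.pow_sup_pow_eq_top (m := k + 1) (n := k) h3
  rw [Ideal.span_singleton_pow] at h4
  obtain ⟨u, hu, v, hv, huv⟩ := Submodule.mem_sup.mp ((Ideal.eq_top_iff_one _).mp h4)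
  obtain ⟨a, rfl⟩ := Ideal.mem_span_singleton'.mp hu
  rw [show p = a * (c ^ (k + 1) * p) + p * v by linear_combination (-p) * huv]
  exact add_mem (Ideal.mul_mem_left _ _ h1) (Ideal.mem_sup_left (Ideal.mul_mem_left _ _ hv))

namespace MvPolynomial

variable {σ : Type*}

theorem mem_idealOfVars_iff {p : MvPolynomial σ K} :
    p ∈ idealOfVars σ K ↔ constantCoeff p = 0 := by
  rw [← pow_one (idealOfVars σ K), ← weightIdeal_one_eq_pow, mem_weightIdeal_iff_coeff]
  constructor
  · intro h
    exact h 0 (by simp)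
  · intro h m hm
    have : m.degree = 0 := by
      rw [Finsupp.degree_eq_weight_one]
      exact Nat.lt_one_iff.mp hm
    rw [Finsupp.degree_eq_zero_iff] at this
    rw [this]; exact h

/-- A hypersurface of dimension `n` through the origin has at least the Hilbert–Samuel function of
affine `n`-space there, as its equation has order at least one. -/
theorem choose_le_finrank_quotient_pow_sup_span [Finite σ] {n : ℕ} (hn : Nat.card σ = n + 1)
    {F : MvPolynomial σ K} (hF0 : F ≠ 0) (hF : F ∈ idealOfVars σ K) (k : ℕ) :
    (k + n).choose n ≤ Module.finrank K
      (MvPolynomial σ K ⧸ (idealOfVars σ K ^ (k + 1) ⊔ Ideal.span {F})) := by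
  have hF0' : (F : MvPowerSeries σ K) ≠ 0 := fun h => hF0 (coe_injective σ K (by simpa using h))
  obtain ⟨d, hd⟩ := ENat.ne_top_iff_exists.mp
    (mt (MvPowerSeries.weightedOrder_eq_top_iff (1 : σ → ℕ)).mp hF0')
  have hd1 : 1 ≤ d := by
    rw [← pow_one (idealOfVars σ K), ← weightIdeal_one_eq_pow, mem_weightIdeal, ← hd] at hF
    exact_mod_cast hF
  have h1 := finrank_quotient_weightIdeal_sup_span (w := 1) (by simp) hd.symm (k + 1)
  rw [weightIdeal_one_eq_pow, weightCount_one_succ hn] at h1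
  have h2 := weightCount_mono (1 : σ → ℕ) (by simp) (show k + 1 - d ≤ k by omega)
  omega

/-- The translation automorphism `X j ↦ X j - a j`. -/
def translate (a : σ → K) : MvPolynomial σ K ≃ₐ[K] MvPolynomial σ K :=
  AlgEquiv.ofAlgHom (aeval fun j => X j - C (a j)) (aeval fun j => X j + C (a j))
    (by ext j : 1; simp) (by ext j : 1; simp)

theorem choose_le_finrank_quotient_pow_sup_span_of_mem [Finite σ] {n : ℕ}
    (hn : Nat.card σ = n + 1) {F : MvPolynomial σ K} (hF0 : F ≠ 0) (a : σ → K)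
    (𝔪 : Ideal (MvPolynomial σ K)) (h𝔪 : 𝔪 ≠ ⊤) (ha : ∀ j, X j - C (a j) ∈ 𝔪) (hF : F ∈ 𝔪) (k : ℕ) :
    (k + n).choose n ≤ Module.finrank K
      (MvPolynomial σ K ⧸ (𝔪 ^ (k + 1) ⊔ Ideal.span {F})) := by
  let τ := translate a
  have hτX : ∀ j, τ (X j) = X j - C (a j) := fun j => aeval_X _ _
  have hle : (idealOfVars σ K).map (τ : MvPolynomial σ K →+* MvPolynomial σ K) ≤ 𝔪 := by
    rw [idealOfVars, Ideal.map_span, Ideal.span_le]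
    rintro _ ⟨_, ⟨j, rfl⟩, rfl⟩
    exact (hτX j).symm ▸ ha j
  have heq : ∀ p, τ p ∈ 𝔪 → p ∈ idealOfVars σ K := by
    intro p hp
    rw [mem_idealOfVars_iff]
    by_contra h
    have h1 : p - C (constantCoeff p) ∈ idealOfVars σ K := by
      rw [mem_idealOfVars_iff]; simp
    have h2 := hle (Ideal.mem_map_of_mem _ h1)
    have h3 : τ (C (constantCoeff p)) ∈ 𝔪 := by
      have := sub_mem hp h2
      simpa using this
    rw [← algebraMap_eq, AlgEquiv.commutes] at h3
    exact h𝔪 (Ideal.eq_top_of_isUnit_mem _ h3 ((IsUnit.mk0 _ h).map _))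
  have h𝔪eq : 𝔪 = (idealOfVars σ K).map (τ : MvPolynomial σ K →+* MvPolynomial σ K) := by
    refine le_antisymm (fun p hp => ?_) hle
    obtain ⟨p, rfl⟩ := τ.surjective p
    exact Ideal.mem_map_of_mem _ (heq p hp)
  obtain ⟨G, rfl⟩ := τ.surjective F
  have hG0 : G ≠ 0 := fun h => hF0 (by rw [h, map_zero])
  refine (choose_le_finrank_quotient_pow_sup_span hn hG0 (heq G hF) k).trans_eq ?_
  refine LinearEquiv.finrank_eq (Ideal.quotientEquivAlg _ _ τ ?_).toLinearEquiv
  have h1 : (Ideal.span {G}).map (τ : MvPolynomial σ K →+* MvPolynomial σ K) =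
      Ideal.span {τ G} := by
    rw [Ideal.map_span, Set.image_singleton]; rfl
  rw [h𝔪eq, Ideal.map_sup, Ideal.map_pow, ← h1]

/-- Lower bound for the colengths of the powers of any maximal ideal of a finite birational
extension `B` of the coordinate ring of a hypersurface: by semicontinuity it is enough to consider
a nearby point over which `Spec B` is isomorphic to the hypersurface, and there the colength
is computed by one equation vanishing at the point. -/
theorem choose_le_finrank_quotient_pow [Finite σ] [IsAlgClosed K] {n : ℕ}
    (hn : Nat.card σ = n + 1)
    {B : Type*} [CommRing B] [Algebra K B] [Algebra.FiniteType K B]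
    (φ : MvPolynomial σ K →ₐ[K] B) {F c : MvPolynomial σ K} (hF0 : F ≠ 0) (hφF : φ F = 0)
    (hker : ∀ p, φ p = 0 → F ∣ p) (hc : ∀ b, ∃ p, φ c * b = φ p)
    (hcB : ∀ b, φ c * b = 0 → b = 0) (𝔫 : Ideal B) [h𝔫 : 𝔫.IsMaximal] (k : ℕ)
    [Module.Finite K (B ⧸ 𝔫 ^ (k + 1))] :
    (k + n).choose n ≤ Module.finrank K (B ⧸ 𝔫 ^ (k + 1)) := by
  let e := Module.finBasis K (B ⧸ 𝔫 ^ (k + 1))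
  choose b hb using fun j => Ideal.Quotient.mk_surjective (e j)
  obtain ⟨g, hg, hspan⟩ := exists_notMem_forall_span_quotient_pow_eq_top 𝔫 h𝔫.ne_top (k + 1) b
    (by simp_rw [hb]; exact e.span_eq)
  -- a closed point of `Spec B` near `𝔫` at which `φ c` is invertible exists because `B` is a
  -- Jacobson ring and `g * φ c` is not nilpotent
  have hnil : g * φ c ∉ nilradical B := by
    rintro ⟨s, hs⟩
    have h1 : ∀ t, φ c ^ t * g ^ s = 0 → g ^ s = 0 := by
      intro t
      induction t with
      | zero => simp
      | succ t ih => exact fun h => ih (hcB _ (by rw [← h]; ring))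
    have h2 := h1 s (by rw [← hs]; ring)
    exact hg (h𝔫.isPrime.mem_of_pow_mem s (h2 ▸ zero_mem _))
  have : IsJacobsonRing B := isJacobsonRing_of_finiteType (A := K)
  have hjac : g * φ c ∉ (nilradical B).jacobson := by
    rwa [‹IsJacobsonRing B›.out (show (nilradical B).IsRadical from Ideal.radical_isRadical _)]
  rw [Ideal.jacobson, Ideal.mem_sInf] at hjac
  push Not at hjac
  obtain ⟨𝔫', ⟨_, hmax⟩, hgc⟩ := hjac
  have hg' : g ∉ 𝔫' := fun h => hgc (Ideal.mul_mem_right _ _ h)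
  have hc' : φ c ∉ 𝔫' := fun h => hgc (Ideal.mul_mem_left _ _ h)
  have hbij := bijective_algebraMap_quotient_of_isMaximal (K := K) 𝔫'
  have hs := hspan 𝔫' hg' hbij
  have hfin : Module.Finite K (B ⧸ 𝔫' ^ (k + 1)) := by
    rw [Module.finite_def, ← hs]
    exact Submodule.fg_span (Set.finite_range _)
  have hle : Module.finrank K (B ⧸ 𝔫' ^ (k + 1)) ≤ Module.finrank K (B ⧸ 𝔫 ^ (k + 1)) := by
    rw [← finrank_top, ← hs]
    exact (finrank_range_le_card _).trans_eq (Fintype.card_fin _)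
  refine le_trans ?_ hle
  choose a ha using fun j => hbij.2 (Ideal.Quotient.mk 𝔫' (φ (X j)))
  have hmax' : (𝔫'.comap φ).IsMaximal := by
    let := Ideal.Quotient.field 𝔫'
    have hsurj : Function.Surjective ((Ideal.Quotient.mk 𝔫').comp (φ : MvPolynomial σ K →+* B)) := by
      intro x
      obtain ⟨y, rfl⟩ := hbij.2 x
      refine ⟨algebraMap K _ y, ?_⟩
      change Ideal.Quotient.mk 𝔫' (φ (algebraMap K _ y)) = _
      rw [AlgHom.commutes]
      rfl
    have h1 := RingHom.ker_isMaximal_of_surjective _ hsurj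
    rwa [← RingHom.comap_ker, Ideal.mk_ker] at h1
  refine (choose_le_finrank_quotient_pow_sup_span_of_mem hn hF0 a (𝔫'.comap φ) hmax'.ne_top
    (fun j => ?_) ?_ k).trans ?_
  · rw [Ideal.mem_comap, ← Ideal.Quotient.eq_zero_iff_mem, map_sub, map_sub, ← ha,
      ← algebraMap_eq, AlgHom.commutes]
    exact sub_self _
  · rw [Ideal.mem_comap, hφF]; exact zero_mem _
  · let f : MvPolynomial σ K →ₐ[K] (B ⧸ 𝔫' ^ (k + 1)) := (Ideal.Quotient.mkₐ K _).comp φ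
    have h1 : RingHom.ker f ≤ 𝔫'.comap φ ^ (k + 1) ⊔ Ideal.span {F} := by
      intro p hp
      have h2 : φ p ∈ 𝔫' ^ (k + 1) := Ideal.Quotient.eq_zero_iff_mem.mp hp
      exact mem_pow_sup_of_map_mem_pow (hm := hmax') (φ : MvPolynomial σ K →+* B) c hc _
        (fun p hp => Ideal.mem_span_singleton.mpr (hker p hp)) 𝔫' hc' _ p h2
    have hinj : Function.Injective (Ideal.kerLiftAlg f).toLinearMap := Ideal.kerLiftAlg_injective f
    have : Module.Finite K (MvPolynomial σ K ⧸ RingHom.ker f) :=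
      Module.Finite.of_injective _ hinj
    exact (finrank_quotient_le_of_le h1).trans
      (LinearMap.finrank_le_finrank_of_injective hinj)

end MvPolynomial

end RationalPoint

/-! ### Comparison of the two bounds -/

namespace MvPolynomial

variable {σ K : Type*} [Field K]

/-- Coordinates in `𝔫 ^ w j` make the `𝔫`-adic filtration on the target dominate the filtration by
weight. -/
theorem map_mem_pow_of_mem_weightIdeal {B : Type*} [CommRing B] [Algebra K B]
    (φ : MvPolynomial σ K →ₐ[K] B) (𝔫 : Ideal B) (w : σ → ℕ) (hw : ∀ j, φ (X j) ∈ 𝔫 ^ w j)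
    {k : ℕ} {p : MvPolynomial σ K} (hp : p ∈ weightIdeal K w k) : φ p ∈ 𝔫 ^ k := by
  rw [mem_weightIdeal_iff_coeff] at hp
  rw [p.as_sum, map_sum]
  refine Ideal.sum_mem _ fun m hm => ?_
  have hk : k ≤ Finsupp.weight w m := by
    by_contra h
    exact mem_support_iff.mp hm (hp m (not_le.mp h))
  refine Ideal.pow_le_pow_right hk ?_
  rw [monomial_eq, map_mul, Finsupp.prod, map_prod]
  refine Ideal.mul_mem_left _ _ ?_
  have h1 : ∏ j ∈ m.support, 𝔫 ^ (m j * w j) = 𝔫 ^ Finsupp.weight w m := by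
    rw [Finset.prod_pow_eq_pow_sum, Finsupp.weight_apply]
    rfl
  rw [← h1]
  refine Ideal.prod_mem_prod fun j _ => ?_
  rw [map_pow, mul_comm, pow_mul]
  exact Ideal.pow_mem_pow (hw j) _

/-- If all coordinates but `r` lie in `𝔫 ^ 2`, the order `e` of `F` at the origin is bounded from
below: `B ⧸ 𝔫 ^ (2 * j)` has dimension at least `2 ^ n * j ^ n / n!` and at most
`e * 2 ^ r * j ^ n / n!`, up to terms of lower order in `j`. -/
theorem two_pow_le_order_mul [Finite σ] [IsAlgClosed K] {n : ℕ} (hn : Nat.card σ = n + 1)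
    {B : Type*} [CommRing B] [Algebra K B] (φ : MvPolynomial σ K →ₐ[K] B)
    (hφ : (φ : MvPolynomial σ K →+* B).Finite)
    {F c : MvPolynomial σ K} (hφF : φ F = 0)
    (hker : ∀ p, φ p = 0 → F ∣ p) (hc : ∀ b, ∃ p, φ c * b = φ p)
    (hcB : ∀ b, φ c * b = 0 → b = 0) (𝔫 : Ideal B) [h𝔫 : 𝔫.IsMaximal] (w : σ → ℕ)
    (hw : ∀ j, w j = 1 ∨ w j = 2) (hφw : ∀ j, φ (X j) ∈ 𝔫 ^ w j) {r : ℕ}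
    (hr : {j | w j = 1}.ncard = r) {e : ℕ}
    (he : (F : MvPowerSeries σ K).weightedOrder (1 : σ → ℕ) = e) :
    2 ^ n ≤ e * 2 ^ r := by
  let P := MvPolynomial σ K
  let m := idealOfVars σ K
  have hw0 : ∀ j, w j ≠ 0 := fun j => by rcases hw j with h | h <;> omega
  have hF0' : (F : MvPowerSeries σ K) ≠ 0 := fun h => by
    rw [h, MvPowerSeries.weightedOrder_zero] at he
    exact ENat.top_ne_natCast _ he
  have hF0 : F ≠ 0 := fun h => hF0' (by rw [h, coe_zero])
  -- the order of `F` for the weights `w` is at most `2 * e`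
  obtain ⟨e', he', hee'⟩ : ∃ e' : ℕ, (F : MvPowerSeries σ K).weightedOrder w = e' ∧ e' ≤ 2 * e := by
    -- the weight of a monomial is at most twice its degree
    obtain ⟨d, hd1, hd2⟩ := ((F : MvPowerSeries σ K).weightedOrder_eq_nat (1 : σ → ℕ)).mp he |>.1
    have h1 := MvPowerSeries.weightedOrder_le w hd1
    have h2 : Finsupp.weight w d ≤ 2 * e := by
      rw [← hd2, Finsupp.weight_apply, Finsupp.weight_apply, Finsupp.sum, Finsupp.sum,
        Finset.mul_sum]
      refine Finset.sum_le_sum fun j _ => ?_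
      rcases hw j with h | h <;> simp [h] <;> omega
    obtain ⟨e', he'⟩ := ENat.ne_top_iff_exists.mp (ne_top_of_le_ne_top (ENat.natCast_ne_top _) h1)
    rw [← he'] at h1
    exact ⟨e', he'.symm, le_trans (by exact_mod_cast h1) h2⟩
  let algPB : Algebra P B := (φ : P →+* B).toAlgebra
  have towerPB : IsScalarTower K P B := IsScalarTower.of_algebraMap_eq fun x => (φ.commutes x).symm
  have finPB : Module.Finite P B := hφ
  have ftB : Algebra.FiniteType K B := Algebra.FiniteType.trans (S := P) inferInstance inferInstance
  obtain ⟨s, b, hb⟩ := Module.Finite.exists_fin (R := P) (M := B)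
  obtain ⟨t, ht⟩ := exists_finrank_quotient_sup_sup_le F c fun p ⟨q, hq⟩ => hker p (hcB _ (by
    rw [← map_mul, hq, map_mul, hφF, zero_mul]))
  -- the upper bound for the colength of `𝔫 ^ k`
  have upper : ∀ k, Module.Finite K (B ⧸ 𝔫 ^ k) ∧ Module.finrank K (B ⧸ 𝔫 ^ k) ≤
      Module.finrank K (P ⧸ (weightIdeal K w k ⊔ Ideal.span {F})) +
        s * Module.finrank K (P ⧸ (m ^ k ⊔ Ideal.span {F} ⊔ Ideal.span {c})) := by
    intro k
    have f1 := finite_quotient_weightIdeal (K := K) w hw0 k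
    have f2 : Module.Finite K (P ⧸ (weightIdeal K w k ⊔ Ideal.span {F})) :=
      finite_quotient_of_le le_sup_left
    have f3 := finite_quotient_weightIdeal (K := K) (1 : σ → ℕ) (by simp) k
    rw [weightIdeal_one_eq_pow] at f3
    have f4 : Module.Finite K (P ⧸ (m ^ k ⊔ Ideal.span {F} ⊔ Ideal.span {c})) :=
      finite_quotient_of_le (le_sup_left.trans le_sup_left : m ^ k ≤ _)
    obtain ⟨h1, h2⟩ := finrank_le_of_smul_mem_span (K := K) (P := P) (D := B ⧸ 𝔫 ^ k)
      (weightIdeal K w k ⊔ Ideal.span {F}) (fun a ha x => by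
        obtain ⟨x, rfl⟩ := Ideal.Quotient.mk_surjective x
        obtain ⟨u, hu, v, hv, rfl⟩ := Submodule.mem_sup.mp ha
        obtain ⟨q, rfl⟩ := Ideal.mem_span_singleton'.mp hv
        have h1 : (u + q * F) • (Ideal.Quotient.mk (𝔫 ^ k) x) =
          Ideal.Quotient.mk (𝔫 ^ k) (φ (u + q * F) * x) := rfl
        have h2 : φ (u + q * F) = φ u := by rw [map_add, map_mul, hφF, mul_zero, add_zero]
        rw [h1, h2, Ideal.Quotient.eq_zero_iff_mem]
        exact Ideal.mul_mem_right _ _ (map_mem_pow_of_mem_weightIdeal φ 𝔫 w hφw hu))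
      c (Ideal.Quotient.mk (𝔫 ^ k) 1) (fun z => by
        obtain ⟨z, rfl⟩ := Ideal.Quotient.mk_surjective z
        obtain ⟨p, hp⟩ := hc z
        refine Submodule.mem_span_singleton.mpr ⟨p, ?_⟩
        change Ideal.Quotient.mk (𝔫 ^ k) (φ p * 1) = Ideal.Quotient.mk (𝔫 ^ k) (φ c * z)
        rw [hp, mul_one])
      (fun j => Ideal.Quotient.mk (𝔫 ^ k) (b j)) (by
        let q : B →ₗ[P] (B ⧸ 𝔫 ^ k) := (Ideal.Quotient.mkₐ P (𝔫 ^ k)).toLinearMap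
        have h1 : Set.range (fun j => Ideal.Quotient.mk (𝔫 ^ k) (b j)) = q '' Set.range b := by
          rw [← Set.range_comp]; rfl
        rw [h1, ← Submodule.map_span, hb, Submodule.map_top, LinearMap.range_eq_top]
        exact Ideal.Quotient.mk_surjective)
    refine ⟨h1, h2.trans (Nat.add_le_add_left (Nat.mul_le_mul_left _ ?_) _)⟩
    exact finrank_quotient_le_of_le (sup_le_sup_right (sup_le_sup_right
      (pow_idealOfVars_le_weightIdeal hw0 k) _) _)
  let U := fun k => (weightCount (1 : σ → ℕ) k : ℝ)
  have hL : ∀ k, (Module.finrank K (P ⧸ (m ^ k ⊔ Ideal.span {F})) : ℝ) = U k - U (k - e) := by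
    intro k
    have h1 := finrank_quotient_weightIdeal_sup_span (w := 1) (by simp) he k
    rw [weightIdeal_one_eq_pow] at h1
    simp only [U, ← h1]
    push_cast
    ring
  have main : ∀ j, e + t + 1 ≤ j → ((2 * j - 1 + n).choose n : ℝ) ≤
      (e * 2 ^ r : ℕ) * ((j + n).choose n : ℝ) +
        s * ((U (2 * j) - U (2 * j - e)) - (U (2 * j - t) - U (2 * j - t - e))) := by
    intro j hj
    obtain ⟨h1, h2⟩ := upper (2 * j)
    have h3 : (2 * j - 1 + n).choose n ≤ Module.finrank K (B ⧸ 𝔫 ^ (2 * j)) := by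
      obtain ⟨l, hl⟩ : ∃ l, 2 * j = l + 1 := ⟨2 * j - 1, by omega⟩
      rw [hl] at h1 ⊢
      exact choose_le_finrank_quotient_pow hn φ hF0 hφF hker hc hcB 𝔫 l
    have h4 := finrank_quotient_weightIdeal_sup_span hw0 he' (2 * j)
    have h5 := weightCount_mono w hw0 (show 2 * (j - e) ≤ 2 * j - e' by omega)
    have h6 := weightCount_two_mul_add_le hn w hw hr (j - e) e
    rw [show j - e + e = j by omega] at h6
    have h7 := ht (2 * j) (by omega)
    have h8 : Module.finrank K (P ⧸ (weightIdeal K w (2 * j) ⊔ Ideal.span {F})) ≤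
        e * (2 ^ r * (j + n).choose n) := by
      have h4' : Module.finrank K (P ⧸ (weightIdeal K w (2 * j) ⊔ Ideal.span {F})) +
        weightCount w (2 * j - e') = weightCount w (2 * j) := h4
      omega
    have h9 : (Module.finrank K (P ⧸ (m ^ (2 * j) ⊔ Ideal.span {F} ⊔ Ideal.span {c})) : ℝ) ≤
        (U (2 * j) - U (2 * j - e)) - (U (2 * j - t) - U (2 * j - t - e)) := by
      rw [← hL, ← hL, le_sub_iff_add_le]
      exact_mod_cast h7
    have h3' : ((2 * j - 1 + n).choose n : ℝ) ≤ (Module.finrank K (B ⧸ 𝔫 ^ (2 * j)) : ℝ) := by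
      exact_mod_cast h3
    have h2' := Nat.cast_le (α := ℝ).mpr h2
    have h8' := Nat.cast_le (α := ℝ).mpr h8
    push_cast at h2' h8' ⊢
    have h9' := mul_le_mul_of_nonneg_left h9 (Nat.cast_nonneg (α := ℝ) s)
    rw [← mul_assoc] at h8'
    linarith
  -- divide by `j ^ n` and let `j` tend to infinity
  have lim : ∀ (φ : ℕ → ℕ) (a l : ℕ), (∀ j, l ≤ j → a * j ≤ φ j + l ∧ φ j ≤ a * j + l) →
      Tendsto (fun j : ℕ => (φ j : ℝ) / j) atTop (𝓝 (a : ℝ)) := by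
    intro φ a l h
    have h1 : Tendsto (fun j : ℕ => (l : ℝ) / j) atTop (𝓝 0) :=
      tendsto_const_div_atTop_nhds_zero_nat _
    have h2 : Tendsto (fun j : ℕ => (a : ℝ) - (l : ℝ) / j) atTop (𝓝 (a : ℝ)) := by
      simpa using (tendsto_const_nhds (x := (a : ℝ))).sub h1
    have h3 : Tendsto (fun j : ℕ => (a : ℝ) + (l : ℝ) / j) atTop (𝓝 (a : ℝ)) := by
      simpa using (tendsto_const_nhds (x := (a : ℝ))).add h1
    refine tendsto_of_tendsto_of_tendsto_of_le_of_le' h2 h3 ?_ ?_ <;>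
    · filter_upwards [eventually_ge_atTop (l + 1)] with j hj
      have hj0 : (0 : ℝ) < j := by exact_mod_cast (by omega : 0 < j)
      obtain ⟨h4, h5⟩ := h j (by omega)
      have h4' : (a : ℝ) * j ≤ φ j + l := by exact_mod_cast h4
      have h5' : (φ j : ℝ) ≤ a * j + l := by exact_mod_cast h5
      field_simp
      linarith
  have infty : ∀ (φ : ℕ → ℕ) (l : ℕ), (∀ j, j ≤ φ j + l) → Tendsto φ atTop atTop := by
    intro φ l h
    exact tendsto_atTop_mono (fun j => Nat.sub_le_iff_le_add.mpr (h j)) (tendsto_sub_atTop_nat l)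
  have t1 := tendsto_choose_div_pow n (fun j => 2 * j - 1 + n) (2 : ℕ)
    (infty _ 1 fun j => by omega) (lim _ 2 (n + 1) fun j _ => by omega)
  have t2 := tendsto_choose_div_pow n (fun j => j + n) (1 : ℕ)
    (infty _ 0 fun j => by omega) (lim _ 1 (n + 1) fun j _ => by omega)
  have t3 := tendsto_weightCount_sub hn e (fun j => 2 * j) (2 : ℕ)
    (infty _ 0 fun j => by omega) (lim _ 2 0 fun j _ => by omega)
  have t4 := tendsto_weightCount_sub hn e (fun j => 2 * j - t) (2 : ℕ)
    (infty _ t fun j => by omega) (lim _ 2 t fun j _ => by omega)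
  have t5 := (t2.const_mul ((e * 2 ^ r : ℕ) : ℝ)).add ((t3.sub t4).const_mul (s : ℝ))
  have hlim := le_of_tendsto_of_tendsto t1 t5 (by
    filter_upwards [eventually_ge_atTop (e + t + 1)] with j hj
    have hj0 : (0 : ℝ) < (j : ℝ) ^ n := pow_pos (by exact_mod_cast (by omega : 0 < j)) n
    rw [div_le_iff₀ hj0]
    refine (main j hj).trans_eq ?_
    simp only [U]
    field_simp)
  have hfac : (0 : ℝ) < n.factorial := by exact_mod_cast n.factorial_pos
  rw [sub_self, mul_zero, add_zero, ← mul_div_assoc, div_le_div_iff_of_pos_right hfac] at hlim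
  simp only [Nat.cast_one, one_pow, mul_one] at hlim
  exact_mod_cast hlim

/-- If `F` is an equation of the hypersurface of which `B` is a finite birational extension, and at
most `n - i` coordinates are not in `𝔫 ^ 2`, then `F` has order at least `2 ^ i` at the origin. -/
theorem mem_idealOfVars_pow_two_pow [Finite σ] [IsAlgClosed K] {n : ℕ} (hn : Nat.card σ = n + 1)
    {B : Type*} [CommRing B] [Algebra K B] (φ : MvPolynomial σ K →ₐ[K] B)
    (hφ : (φ : MvPolynomial σ K →+* B).Finite)
    {F c : MvPolynomial σ K} (hφF : φ F = 0)
    (hker : ∀ p, φ p = 0 → F ∣ p) (hc : ∀ b, ∃ p, φ c * b = φ p)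
    (hcB : ∀ b, φ c * b = 0 → b = 0) (𝔫 : Ideal B) [h𝔫 : 𝔫.IsMaximal] (w : σ → ℕ)
    (hw : ∀ j, w j = 1 ∨ w j = 2) (hφw : ∀ j, φ (X j) ∈ 𝔫 ^ w j) {i : ℕ}
    (hi : {j | w j = 1}.ncard + i ≤ n) :
    F ∈ idealOfVars σ K ^ (2 ^ i) := by
  rw [← weightIdeal_one_eq_pow, mem_weightIdeal]
  by_cases htop : (F : MvPowerSeries σ K).weightedOrder (1 : σ → ℕ) = ⊤
  · rw [htop]; exact le_top
  obtain ⟨e, he⟩ := ENat.ne_top_iff_exists.mp htop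
  have h1 := two_pow_le_order_mul hn φ hφ hφF hker hc hcB 𝔫 w hw hφw rfl he.symm
  rw [← he]
  have h2 : 2 ^ i * 2 ^ {j | w j = 1}.ncard ≤ e * 2 ^ {j | w j = 1}.ncard := by
    rw [← pow_add]
    exact (Nat.pow_le_pow_right two_pos (by omega)).trans h1
  exact_mod_cast Nat.le_of_mul_le_mul_right h2 (by positivity)

end MvPolynomial

end Asymptotics

/-! ### Adapted coordinates on an affine chart -/

/-- In a factorial ring, a reduced hypersurface has a single equation. -/
theorem UniqueFactorizationMonoid.exists_radical_span_singleton_eq {R : Type*} [CommRing R]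
    [IsDomain R] [UniqueFactorizationMonoid R] {a : R} (ha : a ≠ 0) :
    ∃ g : R, (Ideal.span {a}).radical = Ideal.span {g} := by
  let : StrongNormalizationMonoid R := UniqueFactorizationMonoid.strongNormalizationMonoid
  refine ⟨UniqueFactorizationMonoid.radical a, ?_⟩
  ext b
  rw [Ideal.mem_span_singleton, ← UniqueFactorizationMonoid.exists_dvd_pow_iff_radical_dvd ha]
  simp_rw [Ideal.mem_radical_iff, Ideal.mem_span_singleton]

namespace MvPolynomial

variable {K : Type*} [Field K]

/-- The affine change of coordinates `X s ↦ ∑ j, b s j * (X j - a j)` given by a basis `b` of the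
space of linear forms and a point `a`. -/
def affineChange {σ τ : Type*} [Fintype σ] [Fintype τ] [DecidableEq τ]
    (b : Module.Basis σ K (τ → K)) (a : τ → K) :
    MvPolynomial σ K ≃ₐ[K] MvPolynomial τ K :=
  AlgEquiv.ofAlgHom (aeval fun s => ∑ j, C (b s j) * (X j - C (a j)))
    (aeval fun j => (∑ s, C (b.repr (Pi.single j 1) s) * X s) + C (a j))
    (by
      ext j : 1
      have h : ∀ l, ∑ s, b.repr (Pi.single j 1) s * b s l = (Pi.single j 1 : τ → K) l := by
        intro l
        have := congrFun (b.sum_repr (Pi.single j 1)) l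
        simpa using this
      simp only [AlgHom.comp_apply, aeval_X, map_add, map_sum, map_mul, AlgHom.id_apply, algHom_C,
        algebraMap_eq, Finset.mul_sum]
      rw [Finset.sum_comm]
      simp_rw [← mul_assoc, ← C_mul, ← Finset.sum_mul, ← map_sum, h]
      rw [Finset.sum_eq_single j]
      · simp
      · intro l _ hl
        simp [Pi.single_eq_of_ne hl]
      · simp)
    (by
      ext s : 1
      have h : ∀ t, ∑ j, b s j * b.repr (Pi.single j 1) t = (Finsupp.single s 1 : σ →₀ K) t := by
        intro t
        rw [← b.repr_self s]
        conv_rhs => rw [pi_eq_sum_univ' (b s)]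
        simp [Finsupp.finsetSum_apply]
      simp only [AlgHom.comp_apply, aeval_X, map_sub, map_sum, map_mul, AlgHom.id_apply, algHom_C,
        algebraMap_eq, add_sub_cancel_right, Finset.mul_sum]
      rw [Finset.sum_comm]
      simp_rw [← mul_assoc, ← C_mul, ← Finset.sum_mul, ← map_sum, h]
      rw [Finset.sum_eq_single s]
      · simp
      · intro t _ ht
        simp [Finsupp.single_eq_of_ne ht]
      · simp)

theorem affineChange_X {σ τ : Type*} [Fintype σ] [Fintype τ] [DecidableEq τ]
    (b : Module.Basis σ K (τ → K)) (a : τ → K) (s : σ) :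
    affineChange b a (X s) = ∑ j, C (b s j) * (X j - C (a j)) :=
  aeval_X _ _

end MvPolynomial

/-- The theorem on an affine chart `R` of projective space, where `A` is the coordinate ring of the
hypersurface, `B` that of its partial normalization, and the linear forms in `V` are those killed
by the cotangent map at `𝔫`. -/
theorem ker_le_comap_pow_two_pow {K : Type*} [Field K] [IsAlgClosed K] {τ : Type*} [Finite τ]
    {n : ℕ} (hn : Nat.card τ = n + 1) {R A B : Type*} [CommRing R] [CommRing A] [CommRing B]
    (e : MvPolynomial τ K ≃+* R) (α : R →+* A) (hα : Function.Surjective α)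
    (β : A →+* B) (hβ : β.Finite) (hβi : Function.Injective β)
    {F : R} (hF : F ≠ 0) (hker : RingHom.ker α = (Ideal.span {F}).radical)
    {c : A} (hc : ∀ b, ∃ a, β c * b = β a) (hcB : ∀ b, β c * b = 0 → b = 0)
    (𝔫 : Ideal B) [h𝔫 : 𝔫.IsMaximal] (a : τ → K)
    (ha : ∀ j, β (α (e (X j - C (a j)))) ∈ 𝔫) (V : Submodule K (τ → K))
    (hV : ∀ v ∈ V, β (α (e (∑ᶠ j, C (v j) * (X j - C (a j))))) ∈ 𝔫 ^ 2) {i : ℕ}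
    (hi : i + 1 ≤ Module.finrank K V) :
    RingHom.ker α ≤ (𝔫.comap (β.comp α)) ^ (2 ^ i) := by
  classical
  have := Fintype.ofFinite τ
  -- a basis of linear forms whose first vectors span `V`; these get weight two, the others one
  obtain ⟨V', hV'⟩ := V.exists_isCompl
  let bs : Module.Basis (Fin (Module.finrank K V) ⊕ Fin (Module.finrank K V')) K (τ → K) :=
    ((Module.finBasis K V).prod (Module.finBasis K V')).map (Submodule.prodEquivOfIsCompl V V' hV')
  have hbs : ∀ s, bs (Sum.inl s) ∈ V := fun s => by simp [bs]
  let σ := Fin (Module.finrank K V) ⊕ Fin (Module.finrank K V')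
  have hσ : Module.finrank K V + Module.finrank K V' = n + 1 := by
    have h1 := Module.finrank_eq_card_basis bs
    rw [Module.finrank_fintype_fun_eq_card, ← Nat.card_eq_fintype_card, hn] at h1
    simpa using h1.symm
  let θ : MvPolynomial σ K ≃ₐ[K] MvPolynomial τ K := affineChange bs a
  have hθX : ∀ s, θ (X s) = ∑ j, C (bs s j) * (X j - C (a j)) := affineChange_X bs a
  let ρ : MvPolynomial σ K →+* R := (e : MvPolynomial τ K →+* R).comp (θ : MvPolynomial σ K →+* _)
  have hρ : Function.Bijective ρ := e.bijective.comp θ.bijective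
  have hF' : e.symm F ≠ 0 := fun h => hF (by simpa using h)
  obtain ⟨G, hG⟩ := UniqueFactorizationMonoid.exists_radical_span_singleton_eq hF'
  have hmem : ∀ p : MvPolynomial τ K, α (e p) = 0 ↔ G ∣ p := by
    intro p
    rw [← RingHom.mem_ker, hker, ← Ideal.mem_span_singleton, ← hG, Ideal.mem_radical_iff,
      Ideal.mem_radical_iff]
    simp_rw [Ideal.mem_span_singleton, ← map_pow]
    refine exists_congr fun m => ?_
    rw [← map_dvd_iff e.symm, RingEquiv.symm_apply_apply]
  let algB : Algebra K B := ((β.comp (α.comp ρ)).comp C).toAlgebra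
  let φ : MvPolynomial σ K →ₐ[K] B :=
    { toRingHom := β.comp (α.comp ρ)
      commutes' := fun _ => rfl }
  have hφ : ∀ p, φ p = β (α (e (θ p))) := fun _ => rfl
  have hαρ : Function.Surjective (α.comp ρ) := hα.comp hρ.2
  obtain ⟨c', hc'⟩ := hαρ c
  have hφc : φ c' = β c := congrArg β hc'
  have hcore := mem_idealOfVars_pow_two_pow (F := θ.symm G) (c := c') (i := i) (n := n)
    (by simpa [σ] using hσ) φ
    (hβ.comp (RingHom.Finite.of_surjective _ hαρ))
    (by rw [hφ, AlgEquiv.apply_symm_apply, (hmem G).mpr dvd_rfl, map_zero])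
    (fun p hp => by
      have h1 := hβi (((hφ p).symm.trans hp).trans (map_zero β).symm)
      have h2 := (hmem _).mp h1
      simpa using map_dvd θ.symm h2)
    (fun b => by
      obtain ⟨x, hx⟩ := hc b
      obtain ⟨p, rfl⟩ := hαρ x
      exact ⟨p, by rw [hφc, hx]; rfl⟩)
    (fun b hb => hcB b (by rwa [hφc] at hb)) 𝔫
    (Sum.elim (fun _ => 2) (fun _ => 1)) (by rintro (s | s) <;> simp)
    (by
      rintro (s | s)
      · rw [hφ, hθX]
        have := hV _ (hbs s)
        rw [finsum_eq_sum_of_fintype] at this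
        exact this
      · rw [hφ, hθX, map_sum, map_sum, map_sum]
        simp only [Sum.elim_inr, pow_one]
        refine Ideal.sum_mem _ fun j _ => ?_
        rw [map_mul, map_mul, map_mul]
        exact Ideal.mul_mem_left _ _ (ha j))
    (by
      have h1 : {s : σ | Sum.elim (fun _ => 2) (fun _ => 1) s = 1} =
          Set.range (Sum.inr : Fin (Module.finrank K V') → σ) := by
        ext s
        rcases s with s | s <;> simp
      rw [h1, ← Set.image_univ, Set.ncard_image_of_injective _ Sum.inr_injective, Set.ncard_univ,
        Nat.card_eq_fintype_card, Fintype.card_fin]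
      omega)
  have hvars : (idealOfVars σ K).map ρ ≤ 𝔫.comap (β.comp α) := by
    rw [idealOfVars, Ideal.map_span, Ideal.span_le]
    rintro _ ⟨_, ⟨s, rfl⟩, rfl⟩
    change β (α (e (θ (X s)))) ∈ 𝔫
    rw [hθX, map_sum, map_sum, map_sum]
    refine Ideal.sum_mem _ fun j _ => ?_
    rw [map_mul, map_mul, map_mul]
    exact Ideal.mul_mem_left _ _ (ha j)
  intro x hx
  obtain ⟨p, rfl⟩ := e.surjective x
  obtain ⟨q, rfl⟩ := (hmem p).mp hx
  rw [map_mul]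
  refine Ideal.mul_mem_right _ _ (Ideal.pow_right_mono hvars _ ?_)
  rw [← Ideal.map_pow]
  have h1 := Ideal.mem_map_of_mem ρ hcore
  have h2 : ρ (θ.symm G) = e G := congrArg e (θ.apply_symm_apply G)
  rwa [h2] at h1

/-- Linear relations, with coefficients in a field `K` isomorphic to `k`, among vectors spanning
a `k`-vector space of bounded dimension. -/
theorem exists_submodule_forall_sum_smul_eq_zero {K k M τ : Type*} [Field K] [Field k]
    [AddCommGroup M] [Module k M] [Fintype τ] (ρ : K →+* k) (hρ : Function.Bijective ρ)
    (t : τ → M) :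
    ∃ V : Submodule K (τ → K), (∀ v ∈ V, ∑ j, ρ (v j) • t j = 0) ∧
      Fintype.card τ ≤ Module.finrank K V + Module.finrank k (Submodule.span k (Set.range t)) := by
  let : Algebra K k := ρ.toAlgebra
  let : Module K M := Module.compHom M ρ
  have : IsScalarTower K k M := ⟨fun x y z => mul_smul (ρ x) y z⟩
  let S := Submodule.span k (Set.range t)
  have : Module.Finite k S := Module.Finite.span_of_finite k (Set.finite_range t)
  let f : (τ → K) →ₗ[K] S := Fintype.linearCombination K
    fun j => (⟨t j, Submodule.subset_span ⟨j, rfl⟩⟩ : S)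
  have hKk : Module.finrank K k = 1 := by
    rw [← (AlgEquiv.ofBijective (Algebra.ofId K k) hρ).toLinearEquiv.finrank_eq,
      Module.finrank_self]
  have finKk : Module.Finite K k := Module.finite_of_finrank_eq_succ hKk
  have finKS : Module.Finite K S := Module.Finite.trans k S
  have hS : Module.finrank K S = Module.finrank k S := by
    rw [← Module.finrank_mul_finrank K k S, hKk, one_mul]
  refine ⟨LinearMap.ker f, fun v hv => ?_, ?_⟩
  · have h1 := congrArg Subtype.val (LinearMap.mem_ker.mp hv)
    rw [Fintype.linearCombination_apply] at h1
    rw [AddSubmonoidClass.coe_finsetSum] at h1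
    exact h1
  · have h1 := LinearMap.finrank_range_add_finrank_ker f
    have h2 := Submodule.finrank_le (LinearMap.range f)
    rw [Module.finrank_fintype_fun_eq_card] at h1
    rw [hS] at h2
    change _ ≤ _ + Module.finrank k S
    omega

attribute [local instance] MvPolynomial.gradedAlgebra

/-! ### Standard charts of projective space -/

namespace MvPolynomial

variable {ι K : Type*} [Field K] (j : ι)

theorem X_mem_homogeneousSubmodule : (X j : MvPolynomial ι K) ∈ homogeneousSubmodule ι K 1 :=
  (mem_homogeneousSubmodule _ _).mpr (isHomogeneous_X K j)

/-- The coordinate ring of the affine chart `X j ≠ 0` of projective space. -/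
abbrev ChartRing (K : Type*) [Field K] (j : ι) : Type _ :=
  HomogeneousLocalization.Away (homogeneousSubmodule ι K) (X j)

/-- The coordinates `X l / X j`, as a map from the polynomial ring to the chart `X j ≠ 0`. -/
def chartHom : MvPolynomial {l // l ≠ j} K →+* ChartRing K j :=
  eval₂Hom ((HomogeneousLocalization.fromZeroRingHom (homogeneousSubmodule ι K) _).comp
      (algebraMap K (homogeneousSubmodule ι K 0)))
    fun l => HomogeneousLocalization.Away.mk _ (X_mem_homogeneousSubmodule j) 1 (X l.1)
      (by simpa using X_mem_homogeneousSubmodule l.1)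

theorem val_chartHom_C (c : K) : (chartHom j (C c)).val =
    algebraMap (MvPolynomial ι K) (Localization (Submonoid.powers (X j))) (C c) := by
  rw [chartHom, eval₂Hom_C]
  exact Localization.mk_one_eq_algebraMap _

theorem val_chartHom_X_mul (l : {l // l ≠ j}) : (chartHom (K := K) j (X l)).val *
    algebraMap (MvPolynomial ι K) (Localization (Submonoid.powers (X j))) (X j) =
    algebraMap (MvPolynomial ι K) (Localization (Submonoid.powers (X j))) (X l.1) := by
  rw [chartHom, eval₂Hom_X', HomogeneousLocalization.Away.val_mk, Localization.mk_eq_mk',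
    mul_comm, IsLocalization.mul_mk'_eq_mk'_of_mul, IsLocalization.mk'_eq_iff_eq_mul, ← map_mul]
  simp [mul_comm]

/-- A ring homomorphism `g` agreeing with `f` up to a factor `u` on the variables agrees with `f`
up to `u ^ d` on forms of degree `d`. -/
theorem IsHomogeneous.map_mul_pow_eq {S : Type*} [CommRing S] (f g : MvPolynomial ι K →+* S) (u : S)
    (hC : ∀ c, g (C c) = f (C c)) (hX : ∀ l, g (X l) * u = f (X l)) {d : ℕ}
    {p : MvPolynomial ι K} (hp : p.IsHomogeneous d) : g p * u ^ d = f p := by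
  rw [p.as_sum, map_sum, map_sum, Finset.sum_mul]
  refine Finset.sum_congr rfl fun m hm => ?_
  have hd : m.degree = d := by
    rw [Finsupp.degree_eq_weight_one]
    exact hp (mem_support_iff.mp hm)
  rw [monomial_eq, map_mul, map_mul, hC, mul_assoc, Finsupp.prod, map_prod, map_prod, ← hd,
    Finsupp.degree_apply, ← Finset.prod_pow_eq_pow_sum, ← Finset.prod_mul_distrib]
  congr 1
  refine Finset.prod_congr rfl fun l _ => ?_
  rw [map_pow, map_pow, ← mul_pow, hX]

theorem chartHom_bijective [DecidableEq ι] : Function.Bijective (chartHom (K := K) j) := by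
  let L := Localization (Submonoid.powers (X j : MvPolynomial ι K))
  let v : ChartRing K j →+* L := algebraMap _ _
  have hv : Function.Injective v := HomogeneousLocalization.val_injective _
  -- dehomogenization
  let δ : MvPolynomial ι K →+* MvPolynomial {l // l ≠ j} K :=
    eval₂Hom C fun l => if h : l = j then 1 else X ⟨l, h⟩
  constructor
  · have hδj : δ (X j) = 1 := by simp [δ]
    let δ' : L →+* MvPolynomial {l // l ≠ j} K :=
      IsLocalization.Away.lift (X j) (g := δ) (by rw [hδj]; exact isUnit_one)
    have hδ' : ∀ p, δ' (algebraMap _ _ p) = δ p := fun p => IsLocalization.Away.lift_eq _ _ p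
    have h1 : (δ'.comp v).comp (chartHom j) = RingHom.id _ := by
      refine ringHom_ext (fun c => ?_) fun l => ?_
      · change δ' (chartHom j (C c)).val = C c
        rw [val_chartHom_C, hδ']
        simp [δ]
      · change δ' (chartHom j (X l)).val = X l
        have h2 := congrArg δ' (val_chartHom_X_mul (K := K) j l)
        rw [map_mul, hδ', hδ', hδj, mul_one] at h2
        rw [h2]
        simp [δ, l.2]
    exact Function.LeftInverse.injective (g := δ'.comp v) fun x => RingHom.congr_fun h1 x
  · intro x
    obtain ⟨d, s, hs, rfl⟩ := HomogeneousLocalization.Away.mk_surjective _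
      (X_mem_homogeneousSubmodule j) x
    refine ⟨δ s, hv ?_⟩
    have hs' : s.IsHomogeneous d := by simpa [mem_homogeneousSubmodule] using hs
    have h1 := hs'.map_mul_pow_eq (algebraMap _ L) ((v.comp (chartHom j)).comp δ)
      (algebraMap _ L (X j)) (fun c => by
        change (chartHom j (δ (C c))).val = _
        rw [← val_chartHom_C]
        simp [δ]) (fun l => by
        change (chartHom j (δ (X l))).val * _ = _
        by_cases h : l = j
        · have h3 : δ (X l) = 1 := by simp [δ, h]
          rw [h3, map_one, HomogeneousLocalization.val_one, one_mul, h]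
        · have h3 : δ (X l) = X ⟨l, h⟩ := by simp [δ, h]
          rw [h3, val_chartHom_X_mul])
    rw [HomogeneousLocalization.algebraMap_apply, HomogeneousLocalization.algebraMap_apply,
      HomogeneousLocalization.Away.val_mk, Localization.mk_eq_mk',
      IsLocalization.eq_mk'_iff_mul_eq, map_pow]
    exact h1

/-- The equation `F / X j ^ d` of the form `F` of degree `d` in the chart `X j ≠ 0`. -/
abbrev chartEquation {F : MvPolynomial ι K} {d : ℕ} (hF : F.IsHomogeneous d) : ChartRing K j :=
  HomogeneousLocalization.Away.isLocalizationElem (X_mem_homogeneousSubmodule j)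
    ((mem_homogeneousSubmodule _ _).mpr hF)

theorem chartEquation_ne_zero {F : MvPolynomial ι K} {d : ℕ} (hF : F.IsHomogeneous d)
    (hF0 : F ≠ 0) : chartEquation j hF ≠ 0 := by
  intro h
  have h1 := congrArg HomogeneousLocalization.val h
  rw [HomogeneousLocalization.Away.val_mk, HomogeneousLocalization.val_zero, Localization.mk_eq_mk',
    IsLocalization.mk'_eq_zero_iff] at h1
  obtain ⟨⟨_, k, rfl⟩, h2⟩ := h1
  rcases mul_eq_zero.mp h2 with h3 | h3
  · exact pow_ne_zero k (X_ne_zero j) h3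
  · exact hF0 (by simpa using h3)

theorem Proj_basicOpen_inf_basicOpen {ι K : Type} [Field K] (j : ι) {F : MvPolynomial ι K} {d : ℕ}
    (hF : F.IsHomogeneous d) :
    (Proj (homogeneousSubmodule ι K)).basicOpen
      ((Proj.awayToSection (homogeneousSubmodule ι K) (X j)).hom (chartEquation j hF)) =
    Proj.basicOpen (homogeneousSubmodule ι K) (X j) ⊓
      Proj.basicOpen (homogeneousSubmodule ι K) F := by
  ext x
  rw [SetLike.mem_coe, SetLike.mem_coe, TopologicalSpace.Opens.mem_inf]
  by_cases hx : x ∈ Proj.basicOpen (homogeneousSubmodule ι K) (X j)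
  · rw [Scheme.mem_basicOpen _ _ _ hx]
    have h1 := ConcreteCategory.congr_hom
      (ProjectiveSpectrum.Proj.awayToSection_germ (homogeneousSubmodule ι K) (X j) x hx)
      (chartEquation j hF)
    rw [iff_true_intro hx, true_and, Proj.mem_basicOpen]
    have h2 := congrArg IsUnit h1
    change IsUnit ((Proj (homogeneousSubmodule ι K)).presheaf.germ _ x hx
      ((Proj.awayToSection (homogeneousSubmodule ι K) (X j)).hom (chartEquation j hF))) = IsUnit
        ((AlgebraicGeometry.Proj.stalkIso' (homogeneousSubmodule ι K) x).symm
        (HomogeneousLocalization.mapId (homogeneousSubmodule ι K)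
          (Submonoid.powers_le.mpr hx) (chartEquation j hF))) at h2
    rw [h2, MulEquiv.isUnit_map, ← HomogeneousLocalization.isUnit_iff_isUnit_val]
    have := ProjectiveSpectrum.isPrime x
    change IsUnit (Localization.mk (F ^ 1) ⟨X j ^ d, _⟩ :
      Localization.AtPrime x.asHomogeneousIdeal.toIdeal) ↔ _
    rw [Localization.mk_eq_mk', IsLocalization.AtPrime.isUnit_mk'_iff, pow_one]
    exact Iff.rfl
  · refine ⟨fun h => absurd (Scheme.basicOpen_le _ _ h) hx, fun h => absurd h.1 hx⟩

end MvPolynomial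

/-! ### Local rings and cotangent spaces -/

section LocalRings

theorem IsLocalization.AtPrime.mem_pow_of_algebraMap_mem_maximalIdeal_pow {B O : Type*} [CommRing B]
    [CommRing O] [IsLocalRing O] [Algebra B O] (𝔫 : Ideal B) [h𝔫 : 𝔫.IsMaximal]
    [IsLocalization.AtPrime O 𝔫] (k : ℕ) {b : B}
    (hb : algebraMap B O b ∈ maximalIdeal O ^ k) : b ∈ 𝔫 ^ k := by
  rw [← IsLocalization.AtPrime.map_eq_maximalIdeal 𝔫 O, ← Ideal.map_pow,
    IsLocalization.algebraMap_mem_map_algebraMap_iff 𝔫.primeCompl] at hb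
  obtain ⟨s, hs, h⟩ := hb
  have h3 : Ideal.span {s} ⊔ 𝔫 = ⊤ := by
    rw [sup_comm]
    exact h𝔫.out.2 _ (lt_of_le_of_ne le_sup_left fun h => hs (by
      rw [h]; exact Ideal.mem_sup_right (Ideal.mem_span_singleton_self s)))
  have h4 := Ideal.sup_pow_eq_top (n := k) h3
  obtain ⟨u, hu, v, hv, huv⟩ := Submodule.mem_sup.mp ((Ideal.eq_top_iff_one _).mp h4)
  obtain ⟨a, rfl⟩ := Ideal.mem_span_singleton'.mp hu
  rw [show b = a * (s * b) + b * v by linear_combination (-b) * huv]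
  exact add_mem (Ideal.mul_mem_left _ _ h) (Ideal.mul_mem_left _ _ hv)

/-- If the classes of the coordinate functions `X j - a j` in the cotangent space lie in a subspace
`S`, then a space of at least `card τ - dim S` linear forms vanishes to second order at `𝔫`. -/
theorem exists_submodule_linear_forms {K τ B O : Type*} [Field K] [Fintype τ] [CommRing B]
    [CommRing O] [IsLocalRing O] [Algebra B O] (𝔫 : Ideal B) [h𝔫 : 𝔫.IsMaximal]
    [IsLocalization.AtPrime O 𝔫] (g : MvPolynomial τ K →+* B)
    (hg : ∀ b, ∃ c : K, b - g (C c) ∈ 𝔫) (a : τ → K) (ha : ∀ j, g (X j - C (a j)) ∈ 𝔫)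
    (S : Submodule (ResidueField O) (CotangentSpace O)) [Module.Finite (ResidueField O) S]
    (hS : ∀ (j : τ) (h : algebraMap B O (g (X j - C (a j))) ∈ maximalIdeal O),
      (maximalIdeal O).toCotangent ⟨_, h⟩ ∈ S) :
    ∃ V : Submodule K (τ → K), (∀ v ∈ V, g (∑ᶠ j, C (v j) * (X j - C (a j))) ∈ 𝔫 ^ 2) ∧
      Fintype.card τ ≤ Module.finrank K V + Module.finrank (ResidueField O) S := by
  have hmax : ∀ {b : B}, algebraMap B O b ∈ maximalIdeal O ↔ b ∈ 𝔫 := fun {b} =>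
    IsLocalization.AtPrime.to_map_mem_maximal_iff O 𝔫 b
  let ρ : K →+* ResidueField O := ((residue O).comp (algebraMap B O)).comp (g.comp C)
  have hρ : Function.Bijective ρ := by
    refine ⟨ρ.injective, fun x => ?_⟩
    have h1 : ∀ b, ∃ c : K, residue O (algebraMap B O b) = ρ c := fun b => by
      obtain ⟨c, hc⟩ := hg b
      refine ⟨c, ?_⟩
      rw [← hmax, map_sub, ← residue_eq_zero_iff, map_sub, sub_eq_zero] at hc
      exact hc
    obtain ⟨x, rfl⟩ := residue_surjective x
    obtain ⟨b, s, rfl⟩ := IsLocalization.exists_mk'_eq 𝔫.primeCompl x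
    obtain ⟨c, hc⟩ := h1 b
    obtain ⟨d, hd⟩ := h1 s
    have hd0 : ρ d ≠ 0 := by
      rw [← hd, Ne, residue_eq_zero_iff, hmax]
      exact s.2
    refine ⟨c / d, ?_⟩
    rw [map_div₀, div_eq_iff hd0, ← hc, ← hd, ← map_mul, IsLocalization.mk'_spec]
  let t : τ → CotangentSpace O := fun j =>
    (maximalIdeal O).toCotangent ⟨algebraMap B O (g (X j - C (a j))), hmax.mpr (ha j)⟩
  obtain ⟨V, hV, hcard⟩ := exists_submodule_forall_sum_smul_eq_zero ρ hρ t
  refine ⟨V, fun v hv => ?_, hcard.trans (Nat.add_le_add_left (Submodule.finrank_mono ?_) _)⟩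
  · refine IsLocalization.AtPrime.mem_pow_of_algebraMap_mem_maximalIdeal_pow (O := O) 𝔫 2 ?_
    have h1 : ∑ j, ρ (v j) • t j = (maximalIdeal O).toCotangent
        (∑ j, algebraMap B O (g (C (v j))) •
          ⟨algebraMap B O (g (X j - C (a j))), hmax.mpr (ha j)⟩) := by
      rw [map_sum]
      refine Finset.sum_congr rfl fun j _ => ?_
      rw [map_smul]
      rfl
    rw [hV v hv, eq_comm, Ideal.toCotangent_eq_zero] at h1
    rw [finsum_eq_sum_of_fintype, map_sum, map_sum]
    simpa [Algebra.smul_def] using h1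
  · rw [Submodule.span_le]
    rintro _ ⟨j, rfl⟩
    exact hS j _

/-- The order of vanishing of a closed subscheme can be read off in the coordinate ring of an affine
neighbourhood. -/
theorem IsLocalization.AtPrime.ker_le_maximalIdeal_pow {R A S T : Type*} [CommRing R] [CommRing A]
    [CommRing S] [CommRing T] [IsLocalRing S] [Algebra R S] [Algebra A T]
    (p : Ideal R) [p.IsPrime] [IsLocalization.AtPrime S p] (q : Ideal A) [q.IsPrime]
    [IsLocalization.AtPrime T q] (α : R →+* A) (hα : Function.Surjective α) (hpq : q.comap α = p)
    (φ : S →+* T) (hφ : ∀ r, φ (algebraMap R S r) = algebraMap A T (α r)) {k : ℕ}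
    (hk : RingHom.ker α ≤ p ^ k) : RingHom.ker φ ≤ maximalIdeal S ^ k := by
  intro x hx
  obtain ⟨r, s, rfl⟩ := IsLocalization.exists_mk'_eq p.primeCompl x
  have h1 : algebraMap A T (α r) = 0 := by
    rw [← hφ, ← IsLocalization.mk'_spec S r s, map_mul, RingHom.mem_ker.mp hx, zero_mul]
  obtain ⟨u, hu⟩ := (IsLocalization.map_eq_zero_iff q.primeCompl T (α r)).mp h1
  obtain ⟨v, hv⟩ := hα u
  have hvp : v ∈ p.primeCompl := fun h => u.2 (by
    rw [← hv]; rw [← hpq] at h; exact h)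
  have h2 : v * r ∈ p ^ k := hk (by rw [RingHom.mem_ker, map_mul, hv, hu])
  have h3 : algebraMap R S (v * r) ∈ maximalIdeal S ^ k := by
    rw [← IsLocalization.AtPrime.map_eq_maximalIdeal p S, ← Ideal.map_pow]
    exact Ideal.mem_map_of_mem _ h2
  rw [← Ideal.unit_mul_mem_iff_mem _ (IsLocalization.map_units S s), mul_comm,
    IsLocalization.mk'_spec, ← Ideal.unit_mul_mem_iff_mem _ (IsLocalization.map_units S ⟨v, hvp⟩),
    ← map_mul]
  exact h3

end LocalRings

/-- By prime avoidance for the associated primes, an ideal with zero annihilator in a Noetherian ring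
contains a nonzerodivisor. -/
theorem Ideal.exists_mem_nonZeroDivisor {A : Type*} [CommRing A] [IsNoetherianRing A] (I : Ideal A)
    (hI : ∀ x, (∀ a ∈ I, x * a = 0) → x = 0) : ∃ c ∈ I, ∀ x, c * x = 0 → x = 0 := by
  by_contra! h
  have h1 : (I : Set A) ⊆ ⋃ p ∈ (associatedPrimes.finite A A).toFinset, (p : Set A) := by
    intro c hc
    obtain ⟨x, hx, hx0⟩ := h c hc
    have h2 : c ∈ ⋃ p ∈ associatedPrimes A A, (p : Set A) := by
      rw [biUnion_associatedPrimes_eq_zero_divisors]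
      exact ⟨x, hx0, hx⟩
    simpa using h2
  obtain ⟨p, hp, hIp⟩ := (Ideal.subset_union_prime ⊥ ⊥ fun p hp _ _ =>
    IsAssociatedPrime.isPrime ((associatedPrimes.finite A A).mem_toFinset.mp hp)).mp h1
  have hp' := (associatedPrimes.finite A A).mem_toFinset.mp hp
  obtain ⟨hpr, x, hx⟩ := (isAssociatedPrime_iff).mp hp'
  have hx0 : x = 0 := hI x fun a ha => by
    have h2 := hIp ha
    rw [hx, Submodule.mem_colon_singleton, Submodule.mem_bot, smul_eq_mul] at h2
    rw [mul_comm, h2]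
  refine hpr.ne_top ((Ideal.eq_top_iff_one p).mpr ?_)
  rw [hx, Submodule.mem_colon_singleton, hx0, smul_zero]
  exact zero_mem _

section Tangent

/-- The differential is dual to the cotangent map: a covector in its kernel vanishes on the
`κ(y)`-span of the image of the cotangent map, a span which is needed because the latter is only
semilinear. -/
theorem finrank_span_range_coschemeTangentMap_le {X Y : Scheme.{0}} (f : Y ⟶ X) (y : Y)
    [Module.Finite (ResidueField (Y.presheaf.stalk y)) (CotangentSpace (Y.presheaf.stalk y))] :
    Module.finrank (ResidueField (Y.presheaf.stalk y))
        (Submodule.span (ResidueField (Y.presheaf.stalk y))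
          (Set.range (coschemeTangentMap (f.stalkMap y).hom))) ≤
      Module.finrank (ResidueField (Y.presheaf.stalk y))
        (LinearMap.range (schemeTangentMap f y)) := by
  set S := Submodule.span (ResidueField (Y.presheaf.stalk y))
    (Set.range (coschemeTangentMap (f.stalkMap y).hom)) with hS
  let r := S.dualRestrict
  have hr : Function.Surjective r := Subspace.dualRestrict_surjective
  have hker : LinearMap.ker (schemeTangentMap f y) ≤ LinearMap.ker r := by
    intro l hl
    have h1 : S ≤ LinearMap.ker l := by
      rw [hS, Submodule.span_le]
      rintro _ ⟨x, rfl⟩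
      exact LinearMap.congr_fun (LinearMap.mem_ker.mp hl) x
    ext s
    exact h1 s.2
  have h1 := LinearMap.finrank_range_add_finrank_ker r
  have h2 := LinearMap.finrank_range_add_finrank_ker (schemeTangentMap f y)
  have h3 := Submodule.finrank_mono hker
  rw [LinearMap.range_eq_top.mpr hr, finrank_top, Subspace.dual_finrank_eq] at h1
  exact Nat.le_of_add_le_add_right
    ((h1.trans h2.symm).le.trans (Nat.add_le_add_left h3 _))

end Tangent

/-! ### The conductor of a finite birational morphism -/

section Birational

variable {X Y : Scheme.{0}} (f : Y ⟶ X)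

theorem isIso_app_of_le_of_isIso_morphismRestrict (U : X.Opens) [IsIso (f ∣_ U)] {D : X.Opens}
    (hD : D ≤ U) : IsIso (f.app D) := by
  have h1 : IsIso ((f ∣_ U).app (U.ι ⁻¹ᵁ D)) := inferInstance
  rw [morphismRestrict_app] at h1
  have h2 : IsIso (f.app (U.ι ''ᵁ U.ι ⁻¹ᵁ D)) :=
    @IsIso.of_isIso_comp_right _ _ _ _ _ (f.app (U.ι ''ᵁ U.ι ⁻¹ᵁ D))
      (Y.presheaf.map (eqToHom (image_morphismRestrict_preimage f U (U.ι ⁻¹ᵁ D))).op)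
      inferInstance h1
  rwa [U.ι.image_preimage_eq_opensRange_inf, Scheme.Opens.opensRange_ι, inf_eq_right.mpr hD] at h2

/-- Over a basic open set on which `f` is an isomorphism, the map of coordinate rings is an
isomorphism up to powers of the function defining the open set. -/
theorem exists_pow_of_basicOpen_le (U : X.Opens) [IsIso (f ∣_ U)] {V : X.Opens}
    (hV : IsAffineOpen V) (hV' : IsAffineOpen (f ⁻¹ᵁ V)) (a : Γ(X, V)) (ha : X.basicOpen a ≤ U) :
    (∀ b, ∃ (k : ℕ) (x : Γ(X, V)), f.app V a ^ k * b = f.app V x) ∧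
      ∀ x, f.app V x = 0 → ∃ k : ℕ, a ^ k * x = 0 := by
  have hiso := isIso_app_of_le_of_isIso_morphismRestrict f U ha
  have hbij : Function.Bijective (f.app (X.basicOpen a)) := ConcreteCategory.bijective_of_isIso _
  have hle : f ⁻¹ᵁ X.basicOpen a ≤ f ⁻¹ᵁ V := f.preimage_mono (X.basicOpen_le a)
  let rX := X.presheaf.map (homOfLE (X.basicOpen_le a)).op
  let rY := Y.presheaf.map (homOfLE hle).op
  have hnat : ∀ x, rY (f.app V x) = f.app (X.basicOpen a) (rX x) := fun x =>
    (ConcreteCategory.congr_hom (f.naturality (homOfLE (X.basicOpen_le a)).op) x).symm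
  let algX : Algebra Γ(X, V) Γ(X, X.basicOpen a) := rX.hom.toAlgebra
  let algY : Algebra Γ(Y, f ⁻¹ᵁ V) Γ(Y, f ⁻¹ᵁ X.basicOpen a) := rY.hom.toAlgebra
  have locX : IsLocalization.Away a Γ(X, X.basicOpen a) :=
    hV.isLocalization_of_eq_basicOpen a (homOfLE (X.basicOpen_le a)) rfl
  have locY : IsLocalization.Away (f.app V a) Γ(Y, f ⁻¹ᵁ X.basicOpen a) :=
    hV'.isLocalization_of_eq_basicOpen (f.app V a) (homOfLE hle) (Scheme.preimage_basicOpen f a)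
  have hX0 : ∀ x, rX x = 0 → ∃ k : ℕ, a ^ k * x = 0 := fun x hx => by
    obtain ⟨⟨_, k, rfl⟩, h⟩ := (IsLocalization.map_eq_zero_iff (Submonoid.powers a)
      Γ(X, X.basicOpen a) x).mp hx
    exact ⟨k, h⟩
  have hY0 : ∀ x, rY x = 0 → ∃ k : ℕ, f.app V a ^ k * x = 0 := fun x hx => by
    obtain ⟨⟨_, k, rfl⟩, h⟩ := (IsLocalization.map_eq_zero_iff (Submonoid.powers (f.app V a))
      Γ(Y, f ⁻¹ᵁ X.basicOpen a) x).mp hx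
    exact ⟨k, h⟩
  refine ⟨fun b => ?_, fun x hx => hX0 x (hbij.1 ?_)⟩
  · obtain ⟨z, hz⟩ := hbij.2 (rY b)
    obtain ⟨⟨x, ⟨_, k, rfl⟩⟩, h⟩ := IsLocalization.surj (Submonoid.powers a) z
    have h1 : rX x = z * rX (a ^ k) := h.symm
    have h2 : rY (f.app V a ^ k * b - f.app V x) = 0 := by
      rw [map_sub, hnat, h1, map_mul, map_mul, hz, ← hnat, map_pow, map_pow, map_pow]
      ring
    obtain ⟨m, hm⟩ := hY0 _ h2
    refine ⟨m + k, a ^ m * x, ?_⟩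
    rw [map_mul, map_pow]
    linear_combination hm
  · rw [← hnat, hx, map_zero, map_zero]

/-- A finite birational morphism of reduced schemes is, over an affine open set, given by an
injective ring homomorphism whose cokernel is killed by some `c` regular on the target. -/
theorem IsBirationalMorphism.exists_conductor [IsReduced X] [IsReduced Y] [IsFinite f]
    (hf : IsBirationalMorphism f) {V : X.Opens} (hV : IsAffineOpen V)
    [IsNoetherianRing Γ(X, V)] :
    Function.Injective (f.app V) ∧ ∃ c : Γ(X, V), (∀ b, ∃ x, f.app V c * b = f.app V x) ∧
      ∀ b, f.app V c * b = 0 → b = 0 := by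
  obtain ⟨U, hU, hfU, hiso⟩ := hf
  have hV' : IsAffineOpen (f ⁻¹ᵁ V) := hV.preimage f
  -- `I` is the ideal of functions vanishing outside `U`; density of `U` makes its annihilator zero
  let I : Ideal Γ(X, V) :=
    ⨅ (x : V) (_ : x.1 ∉ U), (maximalIdeal (X.presheaf.stalk x.1)).comap (X.presheaf.germ V x.1 x.2).hom
  have hI : ∀ a, a ∈ I ↔ X.basicOpen a ≤ U := by
    intro a
    simp only [I, Ideal.mem_iInf, Ideal.mem_comap, mem_maximalIdeal, mem_nonunits_iff]
    constructor
    · intro h x hx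
      by_contra hxU
      have hxV := X.basicOpen_le a hx
      exact h ⟨x, hxV⟩ hxU ((Scheme.mem_basicOpen _ _ x hxV).mp hx)
    · intro h x hxU hx
      exact hxU (h ((Scheme.mem_basicOpen _ _ x.1 x.2).mpr hx))
  have hbasis : ∀ x ∈ V, x ∈ U → ∃ a ∈ I, x ∈ X.basicOpen a := by
    intro x hxV hxU
    obtain ⟨a, ha, hx⟩ := hV.exists_basicOpen_le ⟨x, hxU⟩ hxV
    exact ⟨a, (hI a).mpr ha, hx⟩
  obtain ⟨c, hcI, hc⟩ := I.exists_mem_nonZeroDivisor fun x hx => by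
    by_contra hx0
    have hne : (X.basicOpen x : Set X).Nonempty := by
      rw [Set.nonempty_iff_ne_empty, Ne, TopologicalSpace.Opens.coe_eq_empty,
        basicOpen_eq_bot_iff]
      exact hx0
    obtain ⟨q, hq, hqU⟩ := hU.inter_open_nonempty _ (X.basicOpen x).isOpen hne
    obtain ⟨a, haI, hqa⟩ := hbasis q (X.basicOpen_le x hq) hqU
    have h1 : q ∈ X.basicOpen (x * a) := by
      rw [Scheme.basicOpen_mul]; exact ⟨hq, hqa⟩
    rw [hx a haI] at h1
    simp at h1
  obtain ⟨hc1, hc2⟩ := exists_pow_of_basicOpen_le f U hV hV' c ((hI c).mp hcI)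
  have hcpow : ∀ (k : ℕ) x, c ^ k * x = 0 → x = 0 := by
    intro k
    induction k with
    | zero => intro x hx; simpa using hx
    | succ k ih => exact fun x hx => hc x (ih _ (by rw [← hx]; ring))
  have hreg : ∀ b, f.app V c * b = 0 → b = 0 := by
    intro b hb
    by_contra hb0
    have hne : (Y.basicOpen b : Set Y).Nonempty := by
      rw [Set.nonempty_iff_ne_empty, Ne, TopologicalSpace.Opens.coe_eq_empty,
        basicOpen_eq_bot_iff]
      exact hb0
    obtain ⟨y, hy, hyU⟩ := hfU.inter_open_nonempty _ (Y.basicOpen b).isOpen hne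
    obtain ⟨a, haI, hya⟩ := hbasis (f y) (Y.basicOpen_le b hy) hyU
    obtain ⟨ha1, ha2⟩ := exists_pow_of_basicOpen_le f U hV hV' a ((hI a).mp haI)
    obtain ⟨k, x, hx⟩ := ha1 b
    obtain ⟨m, hm⟩ := ha2 (c * x) (by rw [map_mul, ← hx]; linear_combination (f.app V a ^ k) * hb)
    have h1 : a ^ m * x = 0 := hc _ (by rw [← hm]; ring)
    have h2 : f.app V a ^ (m + k) * b = 0 := by
      rw [pow_add, mul_assoc, hx, ← map_pow, ← map_mul, h1, map_zero]
    have h3 : y ∈ Y.basicOpen (f.app V a) := by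
      rw [← Scheme.preimage_basicOpen]; exact hya
    have h4 : y ∈ Y.basicOpen (f.app V a ^ (m + k + 1) * b) := by
      rw [Scheme.basicOpen_mul, Scheme.basicOpen_pow _ _ (Nat.succ_pos _)]; exact ⟨h3, hy⟩
    rw [pow_succ', mul_assoc, h2, mul_zero] at h4
    simp at h4
  refine ⟨?_, ?_⟩
  · rw [injective_iff_map_eq_zero]
    intro x hx
    obtain ⟨k, hk⟩ := hc2 x hx
    exact hcpow k x hk
  · let algB : Algebra Γ(X, V) Γ(Y, f ⁻¹ᵁ V) := (f.app V).hom.toAlgebra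
    have finB : Module.Finite Γ(X, V) Γ(Y, f ⁻¹ᵁ V) := IsFinite.finite_app f V hV
    obtain ⟨s, g, hg⟩ := Module.Finite.exists_fin (R := Γ(X, V)) (M := Γ(Y, f ⁻¹ᵁ V))
    choose k x hx using fun j => hc1 (g j)
    -- finitely many generators over `Γ(X, V)` are multiplied into it by one power of `c`
    refine ⟨c ^ ∑ j, k j, fun b => ?_, fun b hb => ?_⟩
    · have hb : b ∈ Submodule.span Γ(X, V) (Set.range g) := hg ▸ trivial
      obtain ⟨l, rfl⟩ := (Submodule.mem_span_range_iff_exists_fun _).mp hb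
      refine ⟨∑ j, l j * (c ^ (∑ i, k i - k j) * x j), ?_⟩
      rw [map_sum, Finset.mul_sum]
      refine Finset.sum_congr rfl fun j _ => ?_
      have h1 : k j ≤ ∑ i, k i := Finset.single_le_sum (fun _ _ => Nat.zero_le _) (Finset.mem_univ j)
      have h2 : l j • g j = f.app V (l j) * g j := rfl
      rw [h2, map_mul, map_mul, ← hx, map_pow, map_pow]
      conv_lhs => rw [← Nat.sub_add_cancel h1, pow_add]
      ring
    · have : ∀ (k : ℕ) b, f.app V c ^ k * b = 0 → b = 0 := by
        intro k
        induction k with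
        | zero => intro x hx; simpa using hx
        | succ k ih => exact fun x hx => hreg x (ih _ (by rw [← hx]; ring))
      exact this _ b (by rwa [map_pow] at hb)

end Birational

/-! ### The hypersurface in a chart and the multiplicity bound -/

/-- Over an affine open set, the ideal of a reduced closed subscheme with the zero locus of a
single function is the radical of the ideal generated by this function. -/
theorem ker_app_eq_radical_span {X P : Scheme.{0}} (g : X ⟶ P) [IsReduced X] {V : P.Opens}
    (hV : IsAffineOpen V) (s : Γ(P, V)) (hs : ∀ x ∈ V, x ∈ Set.range g ↔ x ∉ P.basicOpen s) :
    RingHom.ker (g.app V).hom = (Ideal.span {s}).radical := by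
  ext a
  have h1 : a ∈ (Ideal.span {s}).radical ↔ P.basicOpen a ≤ P.basicOpen s := by
    rw [← PrimeSpectrum.basicOpen_le_basicOpen_iff]
    constructor
    · intro h
      rw [← hV.fromSpec_image_basicOpen, ← hV.fromSpec_image_basicOpen]
      exact hV.fromSpec.image_mono h
    · intro h
      rw [← hV.fromSpec_preimage_basicOpen, ← hV.fromSpec_preimage_basicOpen]
      exact hV.fromSpec.preimage_mono h
  rw [h1, RingHom.mem_ker, ← basicOpen_eq_bot_iff]
  change X.basicOpen (g.app V a) = ⊥ ↔ _
  rw [← Scheme.preimage_basicOpen, eq_bot_iff]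
  constructor
  · intro h x hx
    by_contra hxs
    obtain ⟨z, rfl⟩ := (hs x (P.basicOpen_le a hx)).mpr hxs
    exact h (show z ∈ g ⁻¹ᵁ P.basicOpen a from hx)
  · intro h z hz
    exact absurd (h hz) ((hs (g z) (P.basicOpen_le a hz)).mp ⟨z, rfl⟩)

/-- The charts `X j ≠ 0` cover projective space. -/
theorem exists_mem_basicOpen_X {ι K : Type} [Field K]
    (x : Proj (homogeneousSubmodule ι K)) :
    ∃ j, x ∈ Proj.basicOpen (homogeneousSubmodule ι K) (X j) := by
  by_contra! h
  simp_rw [Proj.mem_basicOpen, not_not] at h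
  refine ProjectiveSpectrum.not_irrelevant_le x fun p hp => ?_
  have h1 : p ∈ idealOfVars ι K := by
    rw [mem_idealOfVars_iff]
    have h2 := (HomogeneousIdeal.mem_irrelevant_iff _ _).mp hp
    rw [GradedRing.proj_apply] at h2
    have h3 : homogeneousComponent 0 p = 0 := (decomposition.decompose'_apply p 0).symm.trans h2
    rw [homogeneousComponent_zero, C_eq_zero] at h3
    exact h3
  have h2 : idealOfVars ι K ≤ x.asHomogeneousIdeal.toIdeal := by
    rw [idealOfVars, Ideal.span_le]
    rintro _ ⟨j, rfl⟩
    exact h j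
  exact h2 h1

theorem propositionP {n : ℕ} {X Y : Scheme.{0}} (ι : X ⟶ ProjSpaceC (n + 1))
    (hX : IsHypersurface ι) (hYred : IsReduced Y) (hYdim : topologicalKrullDim Y = n)
    (f : Y ⟶ X) (hfin : IsFinite f) (hbir : IsBirationalMorphism f)
    (i : ℕ) (y : Y) (hy : y ∈ dropLocus f i) :
    ((2 ^ i : ℕ) : ℕ∞) ≤ hypersurfaceMultiplicity ι (f y) := by
  obtain ⟨hcl, hXred, d, F, hd, hF, hF0, hrange⟩ := hX
  obtain ⟨hyc, hrank⟩ := hy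
  refine le_iSup₂_of_le (2 ^ i) ?_ le_rfl
  -- an affine chart around the point
  obtain ⟨j, hj⟩ := exists_mem_basicOpen_X (ι (f y))
  set V := Proj.basicOpen (homogeneousSubmodule (Fin (n + 1 + 1)) ℂ) (MvPolynomial.X j) with hVdef
  have hV : IsAffineOpen V := Proj.isAffineOpen_basicOpen _ _ (X_mem_homogeneousSubmodule j) one_pos
  have hVX : IsAffineOpen (ι ⁻¹ᵁ V) := hV.preimage ι
  have hVY : IsAffineOpen (f ⁻¹ᵁ ι ⁻¹ᵁ V) := hVX.preimage f
  let e : MvPolynomial {l // l ≠ j} ℂ ≃+* Γ(ProjSpaceC (n + 1), V) :=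
    (RingEquiv.ofBijective _ (chartHom_bijective j)).trans
      (Proj.basicOpenIsoAway _ _ (X_mem_homogeneousSubmodule j) one_pos).commRingCatIsoToRingEquiv
  let α : Γ(ProjSpaceC (n + 1), V) →+* Γ(X, ι ⁻¹ᵁ V) := (ι.app V).hom
  let β : Γ(X, ι ⁻¹ᵁ V) →+* Γ(Y, f ⁻¹ᵁ ι ⁻¹ᵁ V) := (f.app (ι ⁻¹ᵁ V)).hom
  have hα : Function.Surjective α := ι.app_surjective V hV
  have hβ : β.Finite := IsFinite.finite_app f _ hVX
  have noethA : IsNoetherianRing Γ(X, ι ⁻¹ᵁ V) :=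
    isNoetherianRing_of_surjective _ _ (α.comp e.toRingHom) (hα.comp e.surjective)
  have noethB : IsNoetherianRing Γ(Y, f ⁻¹ᵁ ι ⁻¹ᵁ V) := by
    let := β.toAlgebra
    have : Module.Finite Γ(X, ι ⁻¹ᵁ V) Γ(Y, f ⁻¹ᵁ ι ⁻¹ᵁ V) := hβ
    exact IsNoetherianRing.of_finite Γ(X, ι ⁻¹ᵁ V) _
  -- the equation of the hypersurface in this chart
  let F₀ : Γ(ProjSpaceC (n + 1), V) := (Proj.awayToSection _ _).hom (chartEquation j hF)
  have hF₀ : F₀ ≠ 0 := by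
    have h1 := (Proj.basicOpenIsoAway _ _ (X_mem_homogeneousSubmodule j)
      one_pos).commRingCatIsoToRingEquiv.injective.ne (chartEquation_ne_zero j hF hF0)
    rw [map_zero] at h1
    exact h1
  have hker : RingHom.ker α = (Ideal.span {F₀}).radical := by
    refine ker_app_eq_radical_span ι hV F₀ fun x hx => ?_
    have h1 := Proj_basicOpen_inf_basicOpen j hF
    have h2 : (ProjSpaceC (n + 1)).basicOpen F₀ =
      V ⊓ Proj.basicOpen (homogeneousSubmodule (Fin (n + 1 + 1)) ℂ) F := h1
    rw [h2, hrange, TopologicalSpace.Opens.mem_inf, iff_true_intro hx, true_and, Proj.mem_basicOpen,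
      not_not]
    exact Set.singleton_subset_iff
  obtain ⟨hβi, c, hc, hcB⟩ := IsBirationalMorphism.exists_conductor f hbir hVX
  -- the local rings
  let p := (hV.primeIdealOf ⟨ι (f y), hj⟩).asIdeal
  let q := (hVX.primeIdealOf ⟨f y, hj⟩).asIdeal
  let 𝔫 := (hVY.primeIdealOf ⟨y, hj⟩).asIdeal
  have hmax : 𝔫.IsMaximal := hVY.primeIdealOf_isMaximal_of_isClosed ⟨y, hj⟩ hyc
  have hq : q.comap α = p := by
    have h1 := IsAffineOpen.comap_primeIdealOf_appLE (f := ι) V hV _ hVX le_rfl hj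
    rw [← Scheme.Hom.app_eq_appLE] at h1
    exact congrArg PrimeSpectrum.asIdeal h1
  have hn : 𝔫.comap β = q := by
    have h1 := IsAffineOpen.comap_primeIdealOf_appLE (f := f) _ hVX _ hVY le_rfl hj
    rw [← Scheme.Hom.app_eq_appLE] at h1
    exact congrArg PrimeSpectrum.asIdeal h1
  have hp : 𝔫.comap (β.comp α) = p := by rw [← Ideal.comap_comap, hn, hq]
  let := TopCat.Presheaf.algebra_section_stalk (ProjSpaceC (n + 1)).presheaf (U := V) ⟨ι (f y), hj⟩
  let := TopCat.Presheaf.algebra_section_stalk X.presheaf (U := ι ⁻¹ᵁ V) ⟨f y, hj⟩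
  let := TopCat.Presheaf.algebra_section_stalk Y.presheaf (U := f ⁻¹ᵁ ι ⁻¹ᵁ V) ⟨y, hj⟩
  have : IsLocalization.AtPrime ((ProjSpaceC (n + 1)).presheaf.stalk (ι (f y))) p :=
    hV.isLocalization_stalk ⟨ι (f y), hj⟩
  have : IsLocalization.AtPrime (X.presheaf.stalk (f y)) q := hVX.isLocalization_stalk ⟨f y, hj⟩
  have hloc : IsLocalization.AtPrime (Y.presheaf.stalk y) 𝔫 := hVY.isLocalization_stalk ⟨y, hj⟩
  have : IsNoetherianRing (Y.presheaf.stalk y) :=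
    IsLocalization.isNoetherianRing 𝔫.primeCompl _ noethB
  -- coordinates of the point
  let g : MvPolynomial {l // l ≠ j} ℂ →+* Γ(Y, f ⁻¹ᵁ ι ⁻¹ᵁ V) := (β.comp α).comp e.toRingHom
  have hg : ∀ b, ∃ c : ℂ, b - g (C c) ∈ 𝔫 := by
    let := (g.comp C).toAlgebra
    have hft : g.FiniteType :=
      (hβ.to_finiteType).comp (RingHom.FiniteType.of_surjective (α.comp e.toRingHom) (hα.comp e.surjective))
    have hft' : Algebra.FiniteType ℂ Γ(Y, f ⁻¹ᵁ ι ⁻¹ᵁ V) := by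
      have h1 : (C : ℂ →+* MvPolynomial {l // l ≠ j} ℂ).FiniteType :=
        RingHom.finiteType_algebraMap.mpr
          (inferInstance : Algebra.FiniteType ℂ (MvPolynomial {l // l ≠ j} ℂ))
      exact hft.comp h1
    intro b
    obtain ⟨c, hc⟩ := (bijective_algebraMap_quotient_of_isMaximal (K := ℂ) 𝔫).2
      (Ideal.Quotient.mk 𝔫 b)
    exact ⟨c, Ideal.Quotient.eq.mp hc.symm⟩
  choose a ha using fun l => hg (g (MvPolynomial.X l))
  have ha' : ∀ l, g (MvPolynomial.X l - C (a l)) ∈ 𝔫 := fun l => by rw [map_sub]; exact ha l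
  obtain ⟨W, hW, hcard⟩ := exists_submodule_linear_forms (O := Y.presheaf.stalk y) 𝔫 g hg a ha'
    (Submodule.span _ (Set.range (coschemeTangentMap (f.stalkMap y).hom))) fun l h => by
      have h1 : algebraMap Γ(Y, f ⁻¹ᵁ ι ⁻¹ᵁ V) (Y.presheaf.stalk y) (g (MvPolynomial.X l - C (a l))) =
          (f.stalkMap y).hom (algebraMap Γ(X, ι ⁻¹ᵁ V) (X.presheaf.stalk (f y))
            (α (e (MvPolynomial.X l - C (a l))))) :=
        (Scheme.Hom.germ_stalkMap_apply f (ι ⁻¹ᵁ V) y hj _).symm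
      have h2 : algebraMap Γ(X, ι ⁻¹ᵁ V) (X.presheaf.stalk (f y)) (α (e (MvPolynomial.X l - C (a l)))) ∈
          maximalIdeal (X.presheaf.stalk (f y)) := by
        rw [IsLocalization.AtPrime.to_map_mem_maximal_iff _ q, ← hn]
        exact ha' l
      refine Submodule.subset_span ⟨(maximalIdeal _).toCotangent ⟨_, h2⟩, ?_⟩
      rw [coschemeTangentMap_toCotangent _ _ (h1 ▸ h)]
      exact congrArg _ (Subtype.ext h1.symm)
  have hWi : i + 1 ≤ Module.finrank ℂ W := by
    have h1 := finrank_span_range_coschemeTangentMap_le f y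
    have h2 : Fintype.card {l // l ≠ j} = n + 1 := by simp
    rw [hYdim] at hrank
    have h3 : Module.finrank (ResidueField (Y.presheaf.stalk y))
      (LinearMap.range (schemeTangentMap f y)) + i ≤ n := by exact_mod_cast hrank
    omega
  refine IsLocalization.AtPrime.ker_le_maximalIdeal_pow p q α hα hq _
    (fun r => Scheme.Hom.germ_stalkMap_apply ι V (f y) hj r) ?_
  rw [← hp]
  exact ker_le_comap_pow_two_pow (n := n) (by simp) e α hα β hβ hβi hF₀ hker hc hcB 𝔫 a ha' W hW hWi

end
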